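/- Let $d,m\in\mathbb N$ and $1<p<\infty$. Let $A\subset\mathbb R^d$ be an open set with Lipschitz boundary (near every boundary point, in suitable orthonormal coordinates, $A$ is the strict subgraph of a Lipschitz function), and suppose that $\partial A$ is bounded. For $\varepsilon,r>0$ and $u\in L^p(A;\mathbb R^m)$ put $$G^r_\varepsilon(u,A)=\int_{B_r}\int_{\{x\in A\,:\,x+\varepsilon\xi\in A\}}\Bigl|\frac{u(x+\varepsilon\xi)-u(x)}{\varepsilon}\Bigr|^p\,dx\,d\xi\in[0,+\infty],$$ where $B_\rho$ is the open ball of centre $0$ and radius $\rho$. Let $\{u_\varepsilon\}_{\varepsilon>0}\subset L^p(A;\mathbb R^m)$ be such that for some $r>0$ $$\sup_{\varepsilon>0}\bigl\{\|u_\varepsilon\|_{L^p(A;\mathbb R^m)}+G^r_\varepsilon(u_\varepsilon,A)\bigr\}<+\infty.$$ If $A$ is unbounded, assume in addition that for every $\eta>0$ there exists $r_\eta>0$ such that $$\sup_{\varepsilon>0}\|u_\varepsilon\|_{L^p(A\setminus B_{r_\eta};\mathbb R^m)}<\eta.$$ Then, for every sequence $\varepsilon_j>0$ with $\varepsilon_j\to0$,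 the set $\{u_{\varepsilon_j}\}_j$ is relatively compact in $L^p(A;\mathbb R^m)$, and the limit of every subsequence of $(u_{\varepsilon_j})_j$ that converges in $L^p(A;\mathbb R^m)$ belongs to $W^{1,p}(A;\mathbb R^m)$. -/

import Mathlib

open MeasureTheory Filter Topology
open scoped ENNReal NNReal

noncomputable section

/-- `A` has Lipschitz boundary: around every boundary point and in suitable orthonormal
coordinates, `A` is the strict subgraph of a Lipschitz function. Here `e` is the direction of the
last coordinate, and the remaining coordinates range over the hyperplane orthogonal to `e`. -/
def HasLipschitzBoundary {E : Type*} [NormedAddCommGroup E] [InnerProductSpace ℝ E]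
    (A : Set E) : Prop :=
  ∀ x₀ ∈ frontier A, ∃ e : E, ‖e‖ = 1 ∧
    ∃ (γ : (ℝ ∙ e)ᗮ → ℝ) (K : ℝ≥0), LipschitzWith K γ ∧
      ∃ ρ : ℝ, 0 < ρ ∧ ∀ x ∈ Metric.ball x₀ ρ,
        (x ∈ A ↔ inner ℝ e x < γ ((ℝ ∙ e)ᗮ.orthogonalProjectionOnto x))

/-- The set `A_ε(ξ)` of the points `x ∈ A` with `x + ε ξ ∈ A`. -/
def shiftSet {E : Type*} [NormedAddCommGroup E] [NormedSpace ℝ E]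
    (A : Set E) (ε : ℝ) (ξ : E) : Set E :=
  {x | x ∈ A ∧ x + ε • ξ ∈ A}

/-- The localized convolution functional
`G_ε[a](u, A) = ∫ a(ξ) ∫_{A_ε(ξ)} |(u(x + ε ξ) - u(x)) / ε| ^ p dx dξ`, with values in
`[0, ∞]`. -/
def convFunctional {d m : ℕ} (p : ℝ) (a : EuclideanSpace ℝ (Fin d) → ℝ≥0) (ε : ℝ)
    (u : EuclideanSpace ℝ (Fin d) → EuclideanSpace ℝ (Fin m))
    (A : Set (EuclideanSpace ℝ (Fin d))) : ℝ≥0∞ :=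
  ∫⁻ ξ, (a ξ : ℝ≥0∞) * ∫⁻ x in shiftSet A ε ξ, ‖ε⁻¹ • (u (x + ε • ξ) - u x)‖ₑ ^ p

/-- The functional `G_ε^r(u, A)`, that is, `G_ε[a](u, A)` where `a` is the characteristic function
of the open ball `B_r` centred at the origin. -/
def ballFunctional {d m : ℕ} (p r ε : ℝ)
    (u : EuclideanSpace ℝ (Fin d) → EuclideanSpace ℝ (Fin m))
    (A : Set (EuclideanSpace ℝ (Fin d))) : ℝ≥0∞ :=
  convFunctional p ((Metric.ball 0 r).indicator 1) ε u A

/-- `Du` is a weak gradient of `u` in the open set `A`. -/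
def IsWeakGradient {d m : ℕ} (A : Set (EuclideanSpace ℝ (Fin d)))
    (u : EuclideanSpace ℝ (Fin d) → EuclideanSpace ℝ (Fin m))
    (Du : EuclideanSpace ℝ (Fin d) →
      (EuclideanSpace ℝ (Fin d) →L[ℝ] EuclideanSpace ℝ (Fin m))) : Prop :=
  ∀ φ : EuclideanSpace ℝ (Fin d) → ℝ, ContDiff ℝ (⊤ : ℕ∞) φ → HasCompactSupport φ → tsupport φ ⊆ A →
    ∀ v : EuclideanSpace ℝ (Fin d),
      ∫ x in A, fderiv ℝ φ x v • u x = -∫ x in A, φ x • Du x v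

/-- `u ∈ W^{1,p}(A; ℝ^m)`. -/
def MemW1p {d m : ℕ} (p : ℝ≥0∞) (A : Set (EuclideanSpace ℝ (Fin d)))
    (u : EuclideanSpace ℝ (Fin d) → EuclideanSpace ℝ (Fin m)) : Prop :=
  MemLp u p (volume.restrict A) ∧
    ∃ Du : EuclideanSpace ℝ (Fin d) →
        (EuclideanSpace ℝ (Fin d) →L[ℝ] EuclideanSpace ℝ (Fin m)),
      MemLp Du p (volume.restrict A) ∧ IsWeakGradient A u Du

end

/-!
The compactness statement is proved without extending functions across the boundary of `A`. Every
point of the closure of `A` has a neighbourhood `U` with a uniform interior cone: for all `x ∈ A ∩ U`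
and all `ξ` in a fixed ball `V ⊆ B_r`, the segment from `x` to `x + δ₀ ξ` lies in `A`
(`HasLipschitzBoundary.exists_uniform_cone`). Telescoping along such a segment
(`eLpNorm_shift_sub_le_nat_mul`) bounds the finite differences at scale `N ε ≤ δ₀`, averaged over
`V`, by `(N ε) ^ p` times the energy at scale `ε`. Hence, in `L^p(A ∩ U)`, the function `u_ε` is
within `O(δ)` of its average over the directions in `V` at a scale `N ε ≈ δ`
(`eLpNorm_kernelAverage_sub_rpow_le`). For fixed `δ`, these averages are uniformly bounded and
uniformly Lipschitz (`exists_kernelAverage_bound_lipschitz`), so that they are relatively compact on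
bounded sets. It is convenient to express relative compactness as the Cauchy property along every
free ultrafilter on `ℕ`, because this passes to finite unions of domains (`CauchyAlong.union`);
a finite cover of the bounded part of the closure of `A`, together with the uniform smallness of
the tails, gives the Cauchy property on `A` (`cauchyAlong_of_locally`).

For the regularity of a limit `v`, Fatou's lemma shows that for almost every `ξ ∈ B_r` the
difference quotients in the direction `ξ` are bounded in `L^p` along a subsequence. By weak
compactness and discrete integration by parts, `v` has a weak derivative in `L^p(A)` in the
direction `ξ` (`exists_hasWeakDirDeriv_of_frequently_le`). The directions with this property form a
linear subspace, which contains almost all of a ball and hence is the whole space. Weak compactness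
in `L^p`, `1 < p < ∞`, is obtained without duality: convex combinations of almost minimal norm
converge strongly because `L^p` is uniformly convex (`Lp.exists_forall_eq_of_tendsto_of_norm_le`).
-/

/-! ### Weak sequential compactness in `L^p` through uniform convexity -/

theorem norm_midpoint_rpow_lt {F : Type*} [NormedAddCommGroup F] [NormedSpace ℝ F]
    [StrictConvexSpace ℝ F] {q : ℝ} (hq : 1 < q) {a b : F} (hab : a ≠ b) :
    ‖(1 / 2 : ℝ) • (a + b)‖ ^ q < (‖a‖ ^ q + ‖b‖ ^ q) / 2 := by
  have hq0 : 0 < q := by linarith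
  by_cases h : ‖a‖ = ‖b‖
  · have h1 := (norm_midpoint_lt_iff h).2 hab
    have h2 := Real.rpow_lt_rpow (norm_nonneg _) h1 hq0
    rw [← h]; linarith
  · have h1 : ‖(1 / 2 : ℝ) • (a + b)‖ ≤ (1 / 2 : ℝ) * ‖a‖ + (1 / 2 : ℝ) * ‖b‖ := by
      rw [norm_smul, ← mul_add]
      have : ‖(1 / 2 : ℝ)‖ = 1 / 2 := by norm_num
      rw [this]
      gcongr
      exact norm_add_le a b
    have h2 := (strictConvexOn_rpow hq).2 (norm_nonneg a) (norm_nonneg b) h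
      (by norm_num : (0 : ℝ) < 1 / 2) (by norm_num : (0 : ℝ) < 1 / 2) (by norm_num)
    have h3 := Real.rpow_le_rpow (norm_nonneg _) h1 hq0.le
    simp only [smul_eq_mul] at h2
    linarith

/-- Quantitative strict convexity of `‖·‖ ^ q`. Both sides are homogeneous of degree `q` in
`(a, b)`, so that it suffices to look at the unit sphere of `F × F`, which is compact. -/
theorem exists_norm_sub_rpow_le {F : Type*} [NormedAddCommGroup F] [NormedSpace ℝ F]
    [StrictConvexSpace ℝ F] [FiniteDimensional ℝ F] {q : ℝ} (hq : 1 < q) {η : ℝ} (hη : 0 < η) :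
    ∃ K : ℝ, 0 ≤ K ∧ ∀ a b : F, ‖a - b‖ ^ q ≤ η * (‖a‖ ^ q + ‖b‖ ^ q) +
      K * ((‖a‖ ^ q + ‖b‖ ^ q) / 2 - ‖(1 / 2 : ℝ) • (a + b)‖ ^ q) := by
  have hq0 : 0 < q := by linarith
  have : ProperSpace (F × F) := FiniteDimensional.proper ℝ _
  let gap : F × F → ℝ := fun z => (‖z.1‖ ^ q + ‖z.2‖ ^ q) / 2 - ‖(1 / 2 : ℝ) • (z.1 + z.2)‖ ^ q
  have hgap0 : ∀ z, 0 ≤ gap z := by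
    intro z
    by_cases h : z.1 = z.2
    · have : (1 / 2 : ℝ) • (z.2 + z.2) = z.2 := by rw [← two_smul ℝ, smul_smul]; norm_num
      simp only [gap, h, this]
      linarith
    · have := norm_midpoint_rpow_lt hq h
      simp only [gap]; linarith
  have hgapc : Continuous gap := by
    have : ∀ f : F × F → F, Continuous f → Continuous fun z => ‖f z‖ ^ q := fun f hf =>
      hf.norm.rpow_const fun _ => Or.inr hq0.le
    exact ((this _ continuous_fst).add (this _ continuous_snd)).div_const 2 |>.sub
      (this _ ((continuous_fst.add continuous_snd).const_smul _))
  let Z : Set (F × F) := Metric.sphere 0 1 ∩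
    {z | η * (‖z.1‖ ^ q + ‖z.2‖ ^ q) ≤ ‖z.1 - z.2‖ ^ q}
  have hZ : IsCompact Z := by
    refine (isCompact_sphere 0 1).inter_right (isClosed_le ?_ ?_)
    · exact continuous_const.mul ((continuous_fst.norm.rpow_const fun _ => Or.inr hq0.le).add
        (continuous_snd.norm.rpow_const fun _ => Or.inr hq0.le))
    · exact (continuous_fst.sub continuous_snd).norm.rpow_const fun _ => Or.inr hq0.le
  obtain ⟨c, hc, hcZ⟩ : ∃ c : ℝ, 0 < c ∧ ∀ z ∈ Z, c ≤ gap z := by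
    rcases Z.eq_empty_or_nonempty with h | h
    · exact ⟨1, one_pos, by simp [h]⟩
    · obtain ⟨z, hz, hmin⟩ := hZ.exists_isMinOn h hgapc.continuousOn
      refine ⟨gap z, ?_, fun w hw => hmin hw⟩
      have hne : z.1 ≠ z.2 := by
        intro h0
        have h1 := hz.2
        simp only [Set.mem_ofPred_eq, h0, sub_self, norm_zero, Real.zero_rpow hq0.ne'] at h1
        have h2 : 0 ≤ ‖z.2‖ ^ q := by positivity
        have h4 : ‖z.2‖ ^ q = 0 := by nlinarith
        have h5 : z.2 = 0 := by
          rw [Real.rpow_eq_zero (norm_nonneg _) hq0.ne'] at h4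
          exact norm_eq_zero.1 h4
        have : z = 0 := Prod.ext (h0.trans h5) h5
        have h3 := hz.1
        simp [this] at h3
      have := norm_midpoint_rpow_lt hq hne
      simp only [gap]; linarith
  -- on the unit sphere `‖a - b‖ ^ q ≤ 2 ^ q`, while the convexity gap is at least `c` on `Z`
  refine ⟨2 ^ q / c, by positivity, fun a b => ?_⟩
  by_cases h0 : (a, b) = 0
  · simp only [Prod.mk_eq_zero] at h0
    simp [h0.1, h0.2, Real.zero_rpow hq0.ne']
  set s : ℝ := ‖(a, b)‖ with hs
  have hs0 : 0 < s := norm_pos_iff.2 h0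
  by_cases h1 : ‖a - b‖ ^ q ≤ η * (‖a‖ ^ q + ‖b‖ ^ q)
  · have := mul_nonneg (by positivity : 0 ≤ 2 ^ q / c) (hgap0 (a, b))
    simp only [gap] at this
    linarith
  have hsc : ∀ v : F, ‖s⁻¹ • v‖ ^ q = (s⁻¹) ^ q * ‖v‖ ^ q := fun v => by
    rw [norm_smul, Real.mul_rpow (norm_nonneg _) (norm_nonneg _), Real.norm_of_nonneg (by positivity)]
  have hp : 0 < (s⁻¹) ^ q := by positivity
  have hmem : (s⁻¹ • a, s⁻¹ • b) ∈ Z := by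
    refine ⟨?_, ?_⟩
    · rw [mem_sphere_zero_iff_norm, ← Prod.smul_mk, norm_smul, ← hs, norm_inv,
        Real.norm_of_nonneg hs0.le, inv_mul_cancel₀ hs0.ne']
    · simp only [Set.mem_ofPred_eq, ← smul_sub, hsc]
      nlinarith [not_le.1 h1]
  have h2 := hcZ _ hmem
  simp only [gap, ← smul_add, smul_comm (1 / 2 : ℝ) (s⁻¹), hsc] at h2
  have hinv : s ^ q * (s⁻¹) ^ q = 1 := by
    rw [← Real.mul_rpow hs0.le (by positivity), mul_inv_cancel₀ hs0.ne', Real.one_rpow]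
  have hsq : 0 < s ^ q := by positivity
  have h3 : c * s ^ q ≤ gap (a, b) := by
    simp only [gap]
    have h4 := mul_le_mul_of_nonneg_left h2 hsq.le
    have : s ^ q * (((s⁻¹) ^ q * ‖a‖ ^ q + (s⁻¹) ^ q * ‖b‖ ^ q) / 2 -
        (s⁻¹) ^ q * ‖(1 / 2 : ℝ) • (a + b)‖ ^ q) = (s ^ q * (s⁻¹) ^ q) *
        ((‖a‖ ^ q + ‖b‖ ^ q) / 2 - ‖(1 / 2 : ℝ) • (a + b)‖ ^ q) := by ring
    rw [this, hinv] at h4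
    linarith
  have h5 : ‖a - b‖ ^ q ≤ 2 ^ q * s ^ q := by
    rw [← Real.mul_rpow (by norm_num) hs0.le]
    refine Real.rpow_le_rpow (norm_nonneg _) ?_ hq0.le
    have ha : ‖a‖ ≤ s := norm_fst_le (a, b)
    have hb : ‖b‖ ≤ s := norm_snd_le (a, b)
    linarith [norm_sub_le a b]
  have h6 : 2 ^ q * s ^ q ≤ 2 ^ q / c * gap (a, b) := by
    rw [div_mul_eq_mul_div, le_div_iff₀ hc]
    have : (0 : ℝ) ≤ 2 ^ q := by positivity
    nlinarith
  have h7 : 0 ≤ η * (‖a‖ ^ q + ‖b‖ ^ q) := by positivity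
  simp only [gap] at h6
  linarith

/-- The inequality of `exists_norm_sub_rpow_le`, integrated. -/
theorem exists_Lp_norm_sub_rpow_le {X F : Type*} [MeasurableSpace X] (μ : Measure X)
    [NormedAddCommGroup F] [NormedSpace ℝ F] [StrictConvexSpace ℝ F] [FiniteDimensional ℝ F]
    {p : ℝ≥0∞} [Fact (1 ≤ p)] (hp : 1 < p) (hp_top : p ≠ ∞) {η : ℝ} (hη : 0 < η) :
    ∃ K : ℝ, 0 ≤ K ∧ ∀ f g : Lp F p μ, ‖f - g‖ ^ p.toReal ≤
      η * (‖f‖ ^ p.toReal + ‖g‖ ^ p.toReal) + K * ((‖f‖ ^ p.toReal + ‖g‖ ^ p.toReal) / 2 -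
        ‖(1 / 2 : ℝ) • (f + g)‖ ^ p.toReal) := by
  have hp0 : p ≠ 0 := (zero_lt_one.trans hp).ne'
  have hq : 1 < p.toReal := by
    rw [← ENNReal.toReal_one]
    exact (ENNReal.toReal_lt_toReal (by simp) hp_top).2 hp
  have hq0 : 0 < p.toReal := by linarith
  obtain ⟨K, hK0, hK⟩ := exists_norm_sub_rpow_le (F := F) hq hη
  have hint : ∀ f : Lp F p μ, Integrable (fun x => ‖f x‖ ^ p.toReal) μ := fun f =>
    (Lp.memLp f).integrable_norm_rpow hp0 hp_top
  have hnorm : ∀ f : Lp F p μ, ‖f‖ ^ p.toReal = ∫ x, ‖f x‖ ^ p.toReal ∂μ := by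
    intro f
    have h0 : 0 ≤ ∫ x, ‖f x‖ ^ p.toReal ∂μ := integral_nonneg fun x => by positivity
    rw [Lp.norm_def, (Lp.memLp f).eLpNorm_eq_integral_rpow_norm hp0 hp_top,
      ENNReal.toReal_ofReal (by positivity), ← Real.rpow_mul h0, inv_mul_cancel₀ hq0.ne',
      Real.rpow_one]
  refine ⟨K, hK0, fun f g => ?_⟩
  have h1 := hint f
  have h2 := hint g
  have h3 := hint ((1 / 2 : ℝ) • (f + g))
  have h4 : Integrable (fun x => ‖f x‖ ^ p.toReal + ‖g x‖ ^ p.toReal) μ := h1.add h2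
  have h5 : Integrable (fun x => (‖f x‖ ^ p.toReal + ‖g x‖ ^ p.toReal) / 2) μ := h4.div_const 2
  have h6 : Integrable (fun x => (‖f x‖ ^ p.toReal + ‖g x‖ ^ p.toReal) / 2 -
      ‖((1 / 2 : ℝ) • (f + g) : Lp F p μ) x‖ ^ p.toReal) μ := h5.sub h3
  rw [hnorm, hnorm f, hnorm g, hnorm ((1 / 2 : ℝ) • (f + g)), ← integral_add h1 h2,
    ← integral_div, ← integral_sub h5 h3, ← integral_const_mul,
    ← integral_const_mul, ← integral_add (h4.const_mul η) (h6.const_mul K)]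
  refine integral_mono_ae (hint _) ((h4.const_mul η).add (h6.const_mul K)) ?_
  filter_upwards [Lp.coeFn_sub f g, Lp.coeFn_smul (1 / 2 : ℝ) (f + g), Lp.coeFn_add f g]
    with x hx1 hx2 hx3
  simp only [hx1, hx2, Pi.smul_apply, hx3, Pi.add_apply, Pi.sub_apply]
  exact hK _ _

/-- In a complete space satisfying the uniform convexity inequality of
`exists_Lp_norm_sub_rpow_le`, a decreasing sequence of nonempty bounded convex sets has a common
adherent point: elements of almost minimal norm form a Cauchy sequence. -/
theorem exists_mem_iInter_closure_of_uniformly_convex {X : Type*} [NormedAddCommGroup X]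
    [NormedSpace ℝ X] [CompleteSpace X] {q : ℝ} (hq : 0 < q)
    (hX : ∀ η : ℝ, 0 < η → ∃ K : ℝ, 0 ≤ K ∧ ∀ f g : X, ‖f - g‖ ^ q ≤
      η * (‖f‖ ^ q + ‖g‖ ^ q) + K * ((‖f‖ ^ q + ‖g‖ ^ q) / 2 - ‖(1 / 2 : ℝ) • (f + g)‖ ^ q))
    (C : ℕ → Set X) (hC : Antitone C) (hne : ∀ n, (C n).Nonempty) (hconv : ∀ n, Convex ℝ (C n))
    {R : ℝ} (hR : ∀ f ∈ C 0, ‖f‖ ≤ R) : ∃ g, ∀ n, g ∈ closure (C n) := by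
  let i : ℕ → ℝ := fun n => sInf ((fun f : X => ‖f‖ ^ q) '' C n)
  have hbdd : ∀ n, BddBelow ((fun f : X => ‖f‖ ^ q) '' C n) := fun n =>
    ⟨0, by rintro _ ⟨f, -, rfl⟩; positivity⟩
  have hi_le : ∀ n, ∀ f ∈ C n, i n ≤ ‖f‖ ^ q := fun n f hf =>
    csInf_le (hbdd n) (Set.mem_image_of_mem _ hf)
  have hRq : ∀ n, ∀ f ∈ C n, ‖f‖ ^ q ≤ R ^ q := fun n f hf =>
    Real.rpow_le_rpow (norm_nonneg _) (hR f (hC (Nat.zero_le n) hf)) hq.le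
  have hi_mono : Monotone i := fun m n hmn =>
    csInf_le_csInf (hbdd m) ((hne n).image _) (Set.image_mono (hC hmn))
  have hi_bdd : BddAbove (Set.range i) := by
    refine ⟨R ^ q, ?_⟩
    rintro _ ⟨n, rfl⟩
    obtain ⟨f, hf⟩ := hne n
    exact (hi_le n f hf).trans (hRq n f hf)
  have hi_tend := tendsto_atTop_ciSup hi_mono hi_bdd
  set I := ⨆ n, i n
  have hi_I : ∀ n, i n ≤ I := fun n => le_ciSup hi_bdd n
  have hex : ∀ n : ℕ, ∃ f ∈ C n, ‖f‖ ^ q < i n + 1 / ((n : ℝ) + 1) := by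
    intro n
    obtain ⟨_, ⟨f, hf, rfl⟩, hlt⟩ := exists_lt_of_csInf_lt ((hne n).image fun f : X => ‖f‖ ^ q)
      (show i n < i n + 1 / ((n : ℝ) + 1) by
        have : 0 < 1 / ((n : ℝ) + 1) := by positivity
        linarith)
    exact ⟨f, hf, hlt⟩
  choose h hhC hh using hex
  have hcauchy : CauchySeq h := by
    rw [Metric.cauchySeq_iff']
    intro ε hε
    have hR0 : 0 ≤ R ^ q := le_trans (by positivity) (hRq 0 _ (hhC 0))
    obtain ⟨K, hK0, hK⟩ := hX (ε ^ q / (4 * (R ^ q + 1))) (by positivity)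
    have hlim : Tendsto (fun n : ℕ => (I - i n) + 1 / ((n : ℝ) + 1)) atTop (𝓝 ((I - I) + 0)) :=
      (tendsto_const_nhds.sub hi_tend).add tendsto_one_div_add_atTop_nhds_zero_nat
    rw [sub_self, add_zero] at hlim
    obtain ⟨n, hn⟩ := ((hlim.const_mul K).eventually_lt_const
      (show K * 0 < ε ^ q / 4 by rw [mul_zero]; positivity)).exists
    refine ⟨n, fun m hm => ?_⟩
    rw [dist_comm, dist_eq_norm]
    have hmC : h m ∈ C n := hC hm (hhC m)
    have hmid : (1 / 2 : ℝ) • (h n + h m) ∈ C n := by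
      rw [smul_add]
      exact hconv n (hhC n) hmC (by norm_num) (by norm_num) (by norm_num)
    -- the midpoint competes in the infimum `i n`, so the convexity gap of `h n`, `h m` is small
    have h1 := hi_le n _ hmid
    have h2 := hh n
    have h3 := hh m
    have h4 : 1 / ((m : ℝ) + 1) ≤ 1 / ((n : ℝ) + 1) := by gcongr
    have h5 : (‖h n‖ ^ q + ‖h m‖ ^ q) / 2 - ‖(1 / 2 : ℝ) • (h n + h m)‖ ^ q ≤
        (I - i n) + 1 / ((n : ℝ) + 1) := by
      have := hi_I m
      have := hi_I n
      linarith
    have h6 := mul_le_mul_of_nonneg_left h5 hK0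
    have h7 : ε ^ q / (4 * (R ^ q + 1)) * (‖h n‖ ^ q + ‖h m‖ ^ q) ≤ ε ^ q / 2 := by
      rw [div_mul_eq_mul_div, div_le_div_iff₀ (by positivity) (by norm_num)]
      have h8 := hRq 0 _ (hC (Nat.zero_le n) (hhC n))
      have h9 := hRq 0 _ (hC (Nat.zero_le m) (hhC m))
      have : 0 < ε ^ q := by positivity
      nlinarith
    have h10 : ‖h n - h m‖ ^ q < ε ^ q := by
      have := hK (h n) (h m)
      have : 0 < ε ^ q := by positivity
      linarith
    exact lt_of_not_ge fun hge => absurd (Real.rpow_le_rpow hε.le hge hq.le) (not_le.2 h10)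
  obtain ⟨g, hg⟩ := cauchySeq_tendsto_of_complete hcauchy
  refine ⟨g, fun n => mem_closure_of_tendsto hg ?_⟩
  filter_upwards [eventually_ge_atTop n] with m hm
  exact hC hm (hhC m)

/-- Weak compactness of bounded sequences in `L^p`, `1 < p < ∞`: some `g` realizes the limit of
every continuous linear map that converges along the sequence. -/
theorem Lp.exists_forall_eq_of_tendsto_of_norm_le {X F : Type*} [MeasurableSpace X] (μ : Measure X)
    [NormedAddCommGroup F] [NormedSpace ℝ F] [StrictConvexSpace ℝ F] [FiniteDimensional ℝ F]
    {p : ℝ≥0∞} [Fact (1 ≤ p)] (hp : 1 < p) (hp_top : p ≠ ∞) (f : ℕ → Lp F p μ) {R : ℝ}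
    (hR : ∀ n, ‖f n‖ ≤ R) :
    ∃ g : Lp F p μ, ∀ (ℓ : Lp F p μ →L[ℝ] F) (T : F),
      Tendsto (fun n => ℓ (f n)) atTop (𝓝 T) → ℓ g = T := by
  have : CompleteSpace F := FiniteDimensional.complete ℝ F
  obtain ⟨g, hg⟩ := exists_mem_iInter_closure_of_uniformly_convex
    (ENNReal.toReal_pos (zero_lt_one.trans hp).ne' hp_top)
    (fun η hη => exists_Lp_norm_sub_rpow_le μ (F := F) hp hp_top hη)
    (fun n => convexHull ℝ (f '' Set.Ici n))
    (fun m n hmn => convexHull_mono (Set.image_mono (Set.Ici_subset_Ici.2 hmn)))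
    (fun n => ⟨f n, subset_convexHull ℝ _ ⟨n, Set.self_mem_Ici, rfl⟩⟩)
    (fun n => convex_convexHull ℝ _) (R := R)
    (fun h hh => by
      have : convexHull ℝ (f '' Set.Ici 0) ⊆ Metric.closedBall 0 R := by
        refine convexHull_min ?_ (convex_closedBall 0 R)
        rintro _ ⟨n, -, rfl⟩
        simpa using hR n
      simpa using this hh)
  refine ⟨g, fun ℓ T hT => ?_⟩
  refine eq_of_forall_dist_le fun ε hε => ?_
  obtain ⟨n, hn⟩ := eventually_atTop.1 (hT.eventually (Metric.closedBall_mem_nhds T hε))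
  have hsub : closure (convexHull ℝ (f '' Set.Ici n)) ⊆ ℓ ⁻¹' Metric.closedBall T ε := by
    refine closure_minimal (convexHull_min ?_ ?_) (Metric.isClosed_closedBall.preimage ℓ.continuous)
    · rintro _ ⟨m, hm, rfl⟩
      exact hn m hm
    · exact (convex_closedBall T ε).linear_preimage ℓ.toLinearMap
  exact hsub (hg n)

/-! ### Geometry of Lipschitz domains -/

/-- A Lipschitz domain has a uniform interior cone at every point of its closure, and the cone
contains an open set of directions in any prescribed ball about the origin. At a boundary point,
the cone opens in the direction `-e`, where `e` is the direction in which `A` is a subgraph. -/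
theorem HasLipschitzBoundary.exists_uniform_cone {E : Type*} [NormedAddCommGroup E]
    [InnerProductSpace ℝ E] {A : Set E} (hA : HasLipschitzBoundary A) (hA_open : IsOpen A) {r : ℝ}
    (hr : 0 < r) {x₀ : E} (hx₀ : x₀ ∈ closure A) :
    ∃ ρ : ℝ, 0 < ρ ∧ ∃ (ξ₀ : E) (s : ℝ), 0 < s ∧ Metric.ball ξ₀ s ⊆ Metric.ball 0 r ∧
      ∃ δ₀ : ℝ, 0 < δ₀ ∧ ∀ x ∈ A ∩ Metric.ball x₀ ρ, ∀ ξ ∈ Metric.ball ξ₀ s,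
        ∀ t ∈ Set.Icc 0 δ₀, x + t • ξ ∈ A := by
  have hclose : ∀ ρ : ℝ, 0 < ρ → ∀ x ∈ Metric.ball x₀ (ρ / 2), ∀ ξ ∈ Metric.ball (0 : E) r,
      ∀ t ∈ Set.Icc 0 (ρ / (2 * r)), x + t • ξ ∈ Metric.ball x₀ ρ := by
    intro ρ hρ x hx ξ hξ t ht
    rw [mem_ball_iff_norm] at hx ⊢
    rw [mem_ball_zero_iff] at hξ
    have h1 : ‖t • ξ‖ ≤ ρ / 2 := by
      rw [norm_smul, Real.norm_of_nonneg ht.1]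
      calc t * ‖ξ‖ ≤ ρ / (2 * r) * r := by
            gcongr
            exact ht.2
        _ = ρ / 2 := by field_simp
    calc ‖x + t • ξ - x₀‖ = ‖(x - x₀) + t • ξ‖ := by congr 1; abel
      _ ≤ ‖x - x₀‖ + ‖t • ξ‖ := norm_add_le _ _
      _ < ρ := by linarith
  by_cases hxA : x₀ ∈ A
  · obtain ⟨ρ, hρ, hsub⟩ := Metric.isOpen_iff.1 hA_open x₀ hxA
    exact ⟨ρ / 2, by positivity, 0, r, hr, subset_rfl, ρ / (2 * r), by positivity,
      fun x hx ξ hξ t ht => hsub (hclose ρ hρ x hx.2 ξ hξ t ht)⟩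
  · have hfr : x₀ ∈ frontier A := by
      rw [frontier, hA_open.interior_eq]
      exact ⟨hx₀, hxA⟩
    obtain ⟨e, he, γ, K, hγ, ρ, hρ, hiff⟩ := hA x₀ hfr
    -- this `s` satisfies `r / 2 - s ≥ K * s`, which makes the cone steeper than the graph of `γ`
    set s : ℝ := r / (2 * (2 + K)) with hs
    have hs0 : 0 < s := by positivity
    have hsK : s * (2 + K) = r / 2 := by rw [hs]; field_simp
    have hKs : 0 ≤ s * K := by positivity
    have hball : Metric.ball (-(r / 2) • e) s ⊆ Metric.ball 0 r := by
      intro ξ hξ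
      rw [mem_ball_iff_norm] at hξ
      rw [mem_ball_zero_iff]
      have h1 : ‖-(r / 2) • e‖ = r / 2 := by
        rw [norm_smul, he, mul_one, Real.norm_eq_abs, abs_neg, abs_of_pos (by positivity)]
      have := norm_le_norm_add_norm_sub' ξ (-(r / 2) • e)
      linarith
    refine ⟨ρ / 2, by positivity, -(r / 2) • e, s, hs0, hball, ρ / (2 * r), by positivity,
      fun x hx ξ hξ t ht => ?_⟩
    have hx1 : x ∈ Metric.ball x₀ ρ := Metric.ball_subset_ball (by linarith) hx.2
    have hx2 := hclose ρ hρ x hx.2 ξ (hball hξ) t ht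
    have h1 := (hiff x hx1).1 hx.1
    rw [hiff _ hx2]
    obtain ⟨ζ, rfl⟩ : ∃ ζ, ξ = -(r / 2) • e + ζ := ⟨ξ - -(r / 2) • e, by abel⟩
    rw [mem_ball_iff_norm, add_sub_cancel_left] at hξ
    have hort : (ℝ ∙ e)ᗮ.orthogonalProjectionOnto e = 0 :=
      Submodule.orthogonalProjectionOnto_orthogonal_apply_eq_zero
        (Submodule.mem_span_singleton_self e)
    have hproj : (ℝ ∙ e)ᗮ.orthogonalProjectionOnto (x + t • (-(r / 2) • e + ζ)) =
        (ℝ ∙ e)ᗮ.orthogonalProjectionOnto x + t • (ℝ ∙ e)ᗮ.orthogonalProjectionOnto ζ := by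
      simp only [map_add, map_smul, hort, smul_zero, zero_add]
    have hγ1 := hγ.dist_le_mul ((ℝ ∙ e)ᗮ.orthogonalProjectionOnto (x + t • (-(r / 2) • e + ζ)))
      ((ℝ ∙ e)ᗮ.orthogonalProjectionOnto x)
    rw [Real.dist_eq, hproj, dist_eq_norm, add_sub_cancel_left, norm_smul,
      Real.norm_of_nonneg ht.1] at hγ1
    have hζ : ‖(ℝ ∙ e)ᗮ.orthogonalProjectionOnto ζ‖ ≤ s :=
      ((ℝ ∙ e)ᗮ.norm_orthogonalProjectionOnto_apply_le ζ).trans hξ.le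
    have h2 : K * (t * ‖(ℝ ∙ e)ᗮ.orthogonalProjectionOnto ζ‖) ≤ K * (t * s) := by
      have := ht.1
      gcongr
    have h3 := (abs_le.1 (hγ1.trans h2)).1
    have h4 : inner ℝ e ζ ≤ s := by
      have := real_inner_le_norm e ζ
      rw [he, one_mul] at this
      linarith
    have h5 : inner ℝ e (x + t • (-(r / 2) • e + ζ)) =
        inner ℝ e x + t * (-(r / 2) + inner ℝ e ζ) := by
      rw [inner_add_right, inner_smul_right, inner_add_right, inner_smul_right,
        real_inner_self_eq_norm_sq, he]
      ring
    rw [hproj, h5]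
    have h6 : t * (-(r / 2) + inner ℝ e ζ) ≤ t * (-(r / 2) + s) :=
      mul_le_mul_of_nonneg_left (by linarith) ht.1
    have h7 : t * (-(r / 2) + s) ≤ -(K * (t * s)) := by
      have := mul_nonneg ht.1 hs0.le
      have : t * (r / 2) = t * (s * (2 + K)) := by rw [hsK]
      linarith
    linarith

/-! ### Finite differences at a fixed scale -/

theorem isOpen_shiftSet {E : Type*} [NormedAddCommGroup E] [NormedSpace ℝ E] {A : Set E}
    (hA : IsOpen A) (ε : ℝ) (ξ : E) : IsOpen (shiftSet A ε ξ) :=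
  hA.inter (hA.preimage (by fun_prop))

/-- Telescoping along a segment: finite differences with `N` steps of size `ε` are controlled by
those of step `ε`, as long as all intermediate points lie in `A`. -/
theorem eLpNorm_shift_sub_le_nat_mul {E F : Type*} [NormedAddCommGroup E] [NormedSpace ℝ E]
    [MeasurableSpace E] [BorelSpace E] [NormedAddCommGroup F]
    (μ : Measure E) [μ.IsAddRightInvariant] {p : ℝ≥0∞} (hp : 1 ≤ p) {A S : Set E}
    (hA : IsOpen A) {w : E → F} (hw : StronglyMeasurable w) (ε : ℝ) (ξ : E) (N : ℕ)
    (hS : ∀ x ∈ S, ∀ i : ℕ, i ≤ N → x + (i * ε) • ξ ∈ A) :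
    eLpNorm (fun x => w (x + (N * ε) • ξ) - w x) p (μ.restrict S) ≤
      N * eLpNorm (fun x => w (x + ε • ξ) - w x) p (μ.restrict (shiftSet A ε ξ)) := by
  have hshift : ∀ v : E, StronglyMeasurable fun x => w (x + v) := fun v =>
    hw.comp_measurable ((continuous_id.add continuous_const).measurable)
  induction N with
  | zero => simp
  | succ N ih =>
    have h1 := ih fun x hx i hi => hS x hx i (hi.trans (Nat.le_succ N))
    set v : E := (N * ε) • ξ with hv
    have hvv : ∀ x, x + ((N + 1 : ℕ) * ε) • ξ = (x + v) + ε • ξ := fun x => by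
      rw [hv, add_assoc, ← add_smul]; push_cast; ring_nf
    have hfun : (fun x => w (x + ((N + 1 : ℕ) * ε) • ξ) - w x) =
        (fun x => w ((x + v) + ε • ξ) - w (x + v)) + fun x => w (x + v) - w x := by
      funext x
      simp only [hvv, Pi.add_apply]
      abel
    have h2 : eLpNorm (fun x => w ((x + v) + ε • ξ) - w (x + v)) p (μ.restrict S) ≤
        eLpNorm (fun x => w (x + ε • ξ) - w x) p (μ.restrict (shiftSet A ε ξ)) := by
      have hmp := (measurePreserving_add_right μ v).restrict_preimage
        (isOpen_shiftSet hA ε ξ).measurableSet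
      have hD : StronglyMeasurable fun x => w (x + ε • ξ) - w x := (hshift _).sub hw
      rw [← eLpNorm_comp_measurePreserving hD.aestronglyMeasurable hmp]
      refine eLpNorm_mono_measure _ (Measure.restrict_mono (fun x hx => ?_) le_rfl)
      refine ⟨hS x hx N (Nat.le_succ N), ?_⟩
      have := hS x hx (N + 1) le_rfl
      rwa [hvv] at this
    calc eLpNorm (fun x => w (x + ((N + 1 : ℕ) * ε) • ξ) - w x) p (μ.restrict S)
        ≤ _ + _ := by
          rw [hfun]
          refine eLpNorm_add_le ?_ ((hshift v).sub hw).aestronglyMeasurable hp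
          have hv_meas : Measurable fun x : E => x + v :=
            (continuous_id.add continuous_const).measurable
          exact (((hshift _).sub hw).comp_measurable hv_meas).aestronglyMeasurable
      _ ≤ _ := add_le_add h2 h1
      _ = _ := by push_cast; ring

/-! ### Averaging over a cone of directions -/

/-- The average of `w` around `x` with kernel `η` at scale `δ`. The support of `η` need not contain
the origin, so that near the boundary one can average over directions pointing into a domain. -/
noncomputable def kernelAverage {E F : Type*} [NormedAddCommGroup E] [NormedSpace ℝ E]
    [MeasurableSpace E] [NormedAddCommGroup F] [NormedSpace ℝ F] (μ : Measure E) (η : E → ℝ) (δ : ℝ)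
    (w : E → F) (x : E) : F :=
  ∫ ξ, η ξ • w (x + δ • ξ) ∂μ

/-- A Lipschitz probability density supported in a given ball. -/
theorem exists_lipschitz_density {E : Type*} [NormedAddCommGroup E] [NormedSpace ℝ E]
    [MeasurableSpace E] [BorelSpace E] [FiniteDimensional ℝ E] (μ : Measure E)
    [μ.IsAddHaarMeasure] (ξ₀ : E) {s : ℝ} (hs : 0 < s) :
    ∃ (η : E → ℝ) (H : ℝ) (L : ℝ≥0), (∀ ξ, 0 ≤ η ξ) ∧ (∀ ξ, η ξ ≤ H) ∧ LipschitzWith L η ∧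
      (∀ ξ, ξ ∉ Metric.ball ξ₀ s → η ξ = 0) ∧ ∫ ξ, η ξ ∂μ = 1 := by
  have : ProperSpace E := FiniteDimensional.proper ℝ E
  let θ : E → ℝ := fun ξ => max 0 (s - dist ξ ξ₀)
  have hθL : LipschitzWith 1 θ := by
    have h : LipschitzWith 1 fun ξ => s - dist ξ ξ₀ := by
      refine LipschitzWith.of_dist_le_mul fun x y => ?_
      rw [Real.dist_eq, sub_sub_sub_cancel_left, NNReal.coe_one, one_mul, dist_comm x y]
      exact abs_dist_sub_le y x ξ₀
    exact h.const_max 0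
  have hθ0 : ∀ ξ, 0 ≤ θ ξ := fun ξ => le_max_left _ _
  have hsupp : ∀ ξ, ξ ∉ Metric.ball ξ₀ s → θ ξ = 0 := by
    intro ξ hξ
    rw [Metric.mem_ball, not_lt] at hξ
    exact max_eq_left (by linarith)
  have hcs : HasCompactSupport θ := by
    refine HasCompactSupport.intro (isCompact_closedBall ξ₀ s) fun ξ hξ => hsupp ξ fun h => hξ ?_
    exact Metric.ball_subset_closedBall h
  have hpos : 0 < ∫ ξ, θ ξ ∂μ := by
    refine hθL.continuous.integral_pos_of_hasCompactSupport_nonneg_nonzero hcs hθ0 (x := ξ₀) ?_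
    have : θ ξ₀ = s := by simp [θ, hs.le]
    rw [this]
    exact hs.ne'
  refine ⟨fun ξ => (∫ ξ, θ ξ ∂μ)⁻¹ * θ ξ, (∫ ξ, θ ξ ∂μ)⁻¹ * s,
    ‖(∫ ξ, θ ξ ∂μ)⁻¹‖₊ * 1, fun ξ => ?_, fun ξ => ?_, ?_, fun ξ hξ => ?_, ?_⟩
  · have := hθ0 ξ
    positivity
  · refine mul_le_mul_of_nonneg_left ?_ (by positivity)
    exact max_le hs.le (by linarith [dist_nonneg (x := ξ) (y := ξ₀)])
  · refine LipschitzWith.of_dist_le_mul fun x y => ?_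
    have h := hθL.dist_le_mul x y
    rw [Real.dist_eq] at h ⊢
    rw [← mul_sub, abs_mul]
    rw [NNReal.coe_one, one_mul] at h
    rw [mul_one, coe_nnnorm, Real.norm_eq_abs]
    gcongr
  · simp [hsupp ξ hξ]
  · rw [integral_const_mul, inv_mul_cancel₀ hpos.ne']

theorem eLpNorm_comp_add_smul {E F : Type*} [NormedAddCommGroup E] [NormedSpace ℝ E]
    [MeasurableSpace E] [BorelSpace E] [FiniteDimensional ℝ E] (μ : Measure E)
    [μ.IsAddHaarMeasure] [NormedAddCommGroup F] {p : ℝ≥0∞} (hp_top : p ≠ ∞) {w : E → F}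
    (hw : StronglyMeasurable w) (x : E) {δ : ℝ} (hδ : δ ≠ 0) :
    eLpNorm (fun ξ => w (x + δ • ξ)) p μ =
      ENNReal.ofReal |(δ ^ Module.finrank ℝ E)⁻¹| ^ (1 / p).toReal * eLpNorm w p μ := by
  have h1 : eLpNorm (fun y => w (x + y)) p μ = eLpNorm w p μ :=
    eLpNorm_comp_measurePreserving hw.aestronglyMeasurable (measurePreserving_add_left μ x)
  have hwx : StronglyMeasurable fun y => w (x + y) :=
    hw.comp_measurable (measurable_const_add x)
  rw [← h1]
  have h2 := eLpNorm_map_measure (p := p) (μ := μ) (f := fun ξ : E => δ • ξ)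
    (g := fun y => w (x + y)) hwx.aestronglyMeasurable (measurable_const_smul δ).aemeasurable
  rw [Measure.map_addHaar_smul μ hδ, eLpNorm_smul_measure_of_ne_top hp_top, smul_eq_mul] at h2
  exact h2.symm

/-- Rescaled functions `w (x + δ ·)` are bounded in `L¹` of a bounded set, uniformly in `x`, in `w`
ranging over a bounded subset of `L^p`, and in `δ` away from `0`. -/
theorem exists_integral_norm_comp_add_smul_le {E F : Type*} [NormedAddCommGroup E]
    [NormedSpace ℝ E] [MeasurableSpace E] [BorelSpace E] [FiniteDimensional ℝ E] (μ : Measure E)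
    [μ.IsAddHaarMeasure] [NormedAddCommGroup F] {p : ℝ≥0∞} (hp : 1 ≤ p) (hp_top : p ≠ ∞)
    {C : ℝ≥0∞} (hC : C ≠ ∞) {δ : ℝ} (hδ : 0 < δ) {W : Set E} (hW : μ W ≠ ∞) :
    ∃ B : ℝ, 0 ≤ B ∧ ∀ w : E → F, StronglyMeasurable w → eLpNorm w p μ ≤ C → ∀ x : E, ∀ t : ℝ,
      δ ≤ t → IntegrableOn (fun ξ => w (x + t • ξ)) W μ ∧
        ∫ ξ in W, ‖w (x + t • ξ)‖ ∂μ ≤ B := by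
  set B : ℝ≥0∞ := ENNReal.ofReal |(δ ^ Module.finrank ℝ E)⁻¹| ^ (1 / p).toReal * C *
    μ W ^ (1 - 1 / p.toReal) with hB
  have hq : 1 ≤ p.toReal := by
    rw [← ENNReal.toReal_one]
    exact (ENNReal.toReal_le_toReal (by simp) hp_top).2 hp
  have hBtop : B ≠ ∞ := by
    have h1 : (0 : ℝ) ≤ 1 - 1 / p.toReal := by
      rw [sub_nonneg, div_le_one (by linarith)]; exact hq
    refine ENNReal.mul_ne_top (ENNReal.mul_ne_top ?_ hC) (ENNReal.rpow_ne_top_of_nonneg h1 hW)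
    exact ENNReal.rpow_ne_top_of_nonneg ENNReal.toReal_nonneg ENNReal.ofReal_ne_top
  refine ⟨B.toReal, ENNReal.toReal_nonneg, fun w hw hwC x t ht => ?_⟩
  have ht0 : 0 < t := hδ.trans_le ht
  have hwm : StronglyMeasurable fun ξ => w (x + t • ξ) :=
    hw.comp_measurable ((continuous_const.add (continuous_const_smul t)).measurable)
  have h1 : ∫⁻ ξ in W, ‖w (x + t • ξ)‖ₑ ∂μ ≤ B := by
    rw [← eLpNorm_one_eq_lintegral_enorm]
    refine (eLpNorm_le_eLpNorm_mul_rpow_measure_univ hp hwm.aestronglyMeasurable).trans ?_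
    rw [Measure.restrict_apply_univ, ENNReal.toReal_one, div_one, hB]
    gcongr
    refine (eLpNorm_restrict_le _ _ _ _).trans ?_
    rw [eLpNorm_comp_add_smul μ hp_top hw x ht0.ne']
    gcongr
  have hint : IntegrableOn (fun ξ => w (x + t • ξ)) W μ :=
    ⟨hwm.aestronglyMeasurable, h1.trans_lt (lt_top_iff_ne_top.2 hBtop)⟩
  refine ⟨hint, ?_⟩
  rw [integral_norm_eq_lintegral_enorm hwm.aestronglyMeasurable]
  exact ENNReal.toReal_mono hBtop h1

theorem integrable_kernel_smul {E F : Type*} [NormedAddCommGroup E] [NormedSpace ℝ E]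
    [MeasurableSpace E] [BorelSpace E] {μ : Measure E} [NormedAddCommGroup F] [NormedSpace ℝ F]
    {η : E → ℝ} {H : ℝ} (hη_meas : Measurable η) (hη : ∀ ξ, ‖η ξ‖ ≤ H) {W : Set E}
    (hsupp : ∀ ξ, ξ ∉ W → η ξ = 0) {f : E → F} (hf : IntegrableOn f W μ) :
    Integrable (fun ξ => η ξ • f ξ) μ ∧ ‖∫ ξ, η ξ • f ξ ∂μ‖ ≤ H * ∫ ξ in W, ‖f ξ‖ ∂μ := by
  have hsub : (Function.support fun ξ => η ξ • f ξ) ⊆ W := by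
    intro ξ hξ
    by_contra h
    exact hξ (by simp [hsupp ξ h])
  have h1 : IntegrableOn (fun ξ => η ξ • f ξ) W μ :=
    hf.bdd_smul H hη_meas.aestronglyMeasurable (ae_of_all _ hη)
  refine ⟨(integrableOn_iff_integrable_of_support_subset hsub).1 h1, ?_⟩
  rw [← setIntegral_eq_integral_of_forall_compl_eq_zero (s := W)
    fun ξ hξ => by simp [hsupp ξ hξ], ← integral_const_mul]
  refine norm_integral_le_of_norm_le (hf.norm.const_mul H) (ae_of_all _ fun ξ => ?_)
  rw [norm_smul]
  gcongr
  exact hη ξ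

/-- Averages at scales `t ≥ δ` of functions in a bounded subset of `L^p` are uniformly bounded
and uniformly Lipschitz at small distances. -/
theorem exists_kernelAverage_bound_lipschitz {E F : Type*} [NormedAddCommGroup E]
    [NormedSpace ℝ E] [MeasurableSpace E] [BorelSpace E] [FiniteDimensional ℝ E] (μ : Measure E)
    [μ.IsAddHaarMeasure] [NormedAddCommGroup F] [NormedSpace ℝ F] {p : ℝ≥0∞} (hp : 1 ≤ p)
    (hp_top : p ≠ ∞) {C : ℝ≥0∞} (hC : C ≠ ∞) {δ : ℝ} (hδ : 0 < δ) {η : E → ℝ} {H : ℝ} {L : ℝ≥0}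
    {ξ₀ : E} {s : ℝ} (hη0 : ∀ ξ, 0 ≤ η ξ) (hηH : ∀ ξ, η ξ ≤ H) (hηL : LipschitzWith L η)
    (hsupp : ∀ ξ, ξ ∉ Metric.ball ξ₀ s → η ξ = 0) :
    ∃ B : ℝ, 0 ≤ B ∧ ∀ w : E → F, StronglyMeasurable w → eLpNorm w p μ ≤ C → ∀ t : ℝ, δ ≤ t →
      (∀ x, ‖kernelAverage μ η t w x‖ ≤ B) ∧
      ∀ x y, ‖x - y‖ ≤ δ → ‖kernelAverage μ η t w x - kernelAverage μ η t w y‖ ≤ B * ‖x - y‖ := by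
  have hprop : ProperSpace E := FiniteDimensional.proper ℝ E
  set W := Metric.ball ξ₀ (s + 1) with hW
  obtain ⟨B, hB0, hB⟩ := exists_integral_norm_comp_add_smul_le (F := F) μ hp hp_top hC hδ
    (W := W) (measure_ball_lt_top).ne
  have hH0 : 0 ≤ H := (hη0 0).trans (hηH 0)
  have hηm : Measurable η := hηL.continuous.measurable
  have hηn : ∀ ξ, ‖η ξ‖ ≤ H := fun ξ => by rw [Real.norm_of_nonneg (hη0 ξ)]; exact hηH ξ
  have hsuppW : ∀ ξ, ξ ∉ W → η ξ = 0 := fun ξ hξ =>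
    hsupp ξ fun h => hξ (Metric.ball_subset_ball (by linarith) h)
  refine ⟨H * B + L / δ * B, by positivity, fun w hw hwC t ht => ?_⟩
  have ht0 : 0 < t := hδ.trans_le ht
  have hLδ : 0 ≤ L / δ * B := by positivity
  refine ⟨fun x => ?_, fun x y hxy => ?_⟩
  · obtain ⟨hint, hle⟩ := hB w hw hwC x t ht
    refine (integrable_kernel_smul hηm hηn hsuppW hint).2.trans ?_
    have := mul_le_mul_of_nonneg_left hle hH0
    linarith
  · obtain ⟨hint, hle⟩ := hB w hw hwC x t ht
    -- a change of variables moves the displacement `y - x` from `w` to the kernel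
    set v : E := t⁻¹ • (y - x) with hv
    have hvt : t • v = y - x := by rw [hv, smul_smul, mul_inv_cancel₀ ht0.ne', one_smul]
    have hvn : ‖v‖ = t⁻¹ * ‖x - y‖ := by
      rw [hv, norm_smul, norm_inv, Real.norm_of_nonneg ht0.le, norm_sub_rev]
    have hv1 : ‖v‖ ≤ 1 := by
      rw [hvn, inv_mul_le_one₀ ht0]
      exact hxy.trans ht
    have hchange : kernelAverage μ η t w y = ∫ ξ, η (ξ - v) • w (x + t • ξ) ∂μ := by
      rw [← integral_add_right_eq_self _ v, kernelAverage]
      refine integral_congr_ae (ae_of_all _ fun ξ => ?_)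
      simp only [add_sub_cancel_right, smul_add, hvt]
      congr 2
      abel
    have hsuppv : ∀ ξ, ξ ∉ W → η (ξ - v) = 0 := by
      intro ξ hξ
      refine hsupp _ fun h => hξ ?_
      rw [mem_ball_iff_norm] at h ⊢
      calc ‖ξ - ξ₀‖ = ‖(ξ - v - ξ₀) + v‖ := by congr 1; abel
        _ ≤ ‖ξ - v - ξ₀‖ + ‖v‖ := norm_add_le _ _
        _ < s + 1 := by linarith
    have hηvm : Measurable fun ξ => η (ξ - v) := hηm.comp (measurable_sub_const v)
    have h1 := (integrable_kernel_smul hηm hηn hsuppW hint).1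
    have h2 := (integrable_kernel_smul hηvm (fun ξ => hηn _) hsuppv hint).1
    have h3 : kernelAverage μ η t w x - kernelAverage μ η t w y =
        ∫ ξ, (η ξ - η (ξ - v)) • w (x + t • ξ) ∂μ := by
      rw [hchange, kernelAverage, ← integral_sub h1 h2]
      simp only [sub_smul]
    rw [h3]
    have h4 : ∀ ξ, ‖η ξ - η (ξ - v)‖ ≤ L * ‖v‖ := fun ξ => by
      have := hηL.dist_le_mul ξ (ξ - v)
      rwa [dist_eq_norm, dist_eq_norm, sub_sub_cancel] at this
    refine (integrable_kernel_smul (hηm.sub hηvm) h4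
      (fun ξ hξ => by simp [hsuppW ξ hξ, hsuppv ξ hξ]) hint).2.trans ?_
    have h5 : t⁻¹ ≤ δ⁻¹ := by gcongr
    calc L * ‖v‖ * ∫ ξ in W, ‖w (x + t • ξ)‖ ∂μ ≤ L * (δ⁻¹ * ‖x - y‖) * B := by
          rw [hvn]; gcongr
      _ = L / δ * B * ‖x - y‖ := by rw [div_eq_mul_inv]; ring
      _ ≤ (H * B + L / δ * B) * ‖x - y‖ := by
          gcongr
          have : 0 ≤ H * B := by positivity
          linarith

/-- The distance in `L^p(S)` between a function and its average at scale `δ` is controlled by the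
mean finite differences at scale `δ`. -/
theorem eLpNorm_kernelAverage_sub_rpow_le {E F : Type*} [NormedAddCommGroup E]
    [NormedSpace ℝ E] [MeasurableSpace E] [BorelSpace E] [FiniteDimensional ℝ E] (μ : Measure E)
    [μ.IsAddHaarMeasure] [NormedAddCommGroup F] [NormedSpace ℝ F] [CompleteSpace F]
    {p : ℝ≥0∞} (hp : 1 ≤ p)
    (hp_top : p ≠ ∞) {δ : ℝ} (hδ : 0 < δ) {η : E → ℝ} {H : ℝ} {L : ℝ≥0}
    {ξ₀ : E} {s : ℝ} (hη0 : ∀ ξ, 0 ≤ η ξ) (hηH : ∀ ξ, η ξ ≤ H) (hηL : LipschitzWith L η)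
    (hsupp : ∀ ξ, ξ ∉ Metric.ball ξ₀ s → η ξ = 0) (hη1 : ∫ ξ, η ξ ∂μ = 1)
    {w : E → F} (hw : StronglyMeasurable w) (hwp : eLpNorm w p μ ≠ ∞) (S : Set E) :
    eLpNorm (fun x => kernelAverage μ η δ w x - w x) p (μ.restrict S) ^ p.toReal ≤
      (ENNReal.ofReal H * μ (Metric.ball ξ₀ s) ^ (1 - 1 / p.toReal)) ^ p.toReal *
        ∫⁻ ξ in Metric.ball ξ₀ s,
          eLpNorm (fun x => w (x + δ • ξ) - w x) p (μ.restrict S) ^ p.toReal ∂μ := by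
  have hprop : ProperSpace E := FiniteDimensional.proper ℝ E
  have hp0 : p ≠ 0 := (zero_lt_one.trans_le hp).ne'
  have hq : 0 < p.toReal := ENNReal.toReal_pos hp0 hp_top
  have hpow : ∀ (f : E → F) (ν : Measure E), eLpNorm f p ν ^ p.toReal =
      ∫⁻ x, ‖f x‖ₑ ^ p.toReal ∂ν := fun f ν => by
    rw [eLpNorm_eq_lintegral_rpow_enorm_toReal hp0 hp_top, ← ENNReal.rpow_mul,
      one_div_mul_cancel hq.ne', ENNReal.rpow_one]
  have hηm : Measurable η := hηL.continuous.measurable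
  have hηn : ∀ ξ, ‖η ξ‖ ≤ H := fun ξ => by rw [Real.norm_of_nonneg (hη0 ξ)]; exact hηH ξ
  set V := Metric.ball ξ₀ s with hV
  have hVfin : μ V ≠ ∞ := measure_ball_lt_top.ne
  set K := ENNReal.ofReal H * μ V ^ (1 - 1 / p.toReal) with hK
  obtain ⟨B, hB0, hB⟩ := exists_integral_norm_comp_add_smul_le (F := F) μ hp hp_top hwp hδ hVfin
  have hmeas2 : StronglyMeasurable fun z : E × E => w (z.1 + δ • z.2) - w z.1 :=
    (hw.comp_measurable (g := fun z : E × E => z.1 + δ • z.2) (by fun_prop)).sub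
      (hw.comp_measurable measurable_fst)
  have hmeas : Measurable fun z : E × E => ‖w (z.1 + δ • z.2) - w z.1‖ₑ ^ p.toReal :=
    hmeas2.enorm.pow_const _
  have hpt : ∀ x, ‖kernelAverage μ η δ w x - w x‖ₑ ^ p.toReal ≤
      K ^ p.toReal * ∫⁻ ξ in V, ‖w (x + δ • ξ) - w x‖ₑ ^ p.toReal ∂μ := by
    intro x
    have hdm : StronglyMeasurable fun ξ => w (x + δ • ξ) - w x :=
      hmeas2.comp_measurable (g := fun ξ => (x, ξ)) (by fun_prop)
    have hint := (hB w hw le_rfl x δ le_rfl).1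
    have hc : IntegrableOn (fun _ : E => w x) V μ := integrableOn_const hVfin
    have h1 := (integrable_kernel_smul hηm hηn hsupp hint).1
    have h2 := (integrable_kernel_smul hηm hηn hsupp hc).1
    have h3 : kernelAverage μ η δ w x - w x = ∫ ξ, η ξ • (w (x + δ • ξ) - w x) ∂μ := by
      simp only [smul_sub]
      rw [integral_sub h1 h2, integral_smul_const, hη1, one_smul, kernelAverage]
    rw [h3, ← hpow, ← ENNReal.mul_rpow_of_nonneg _ _ hq.le]
    refine ENNReal.rpow_le_rpow ?_ hq.le
    calc ‖∫ ξ, η ξ • (w (x + δ • ξ) - w x) ∂μ‖ₑ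
        = ‖∫ ξ in V, η ξ • (w (x + δ • ξ) - w x) ∂μ‖ₑ := by
          rw [setIntegral_eq_integral_of_forall_compl_eq_zero
            fun ξ hξ => by simp [hsupp ξ hξ]]
      _ ≤ ∫⁻ ξ in V, ‖η ξ • (w (x + δ • ξ) - w x)‖ₑ ∂μ := enorm_integral_le_lintegral_enorm _
      _ ≤ ∫⁻ ξ in V, ENNReal.ofReal H * ‖w (x + δ • ξ) - w x‖ₑ ∂μ := by
          gcongr with ξ
          rw [enorm_smul]
          gcongr
          rw [Real.enorm_eq_ofReal (hη0 ξ)]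
          exact ENNReal.ofReal_le_ofReal (hηH ξ)
      _ = ENNReal.ofReal H * eLpNorm (fun ξ => w (x + δ • ξ) - w x) 1 (μ.restrict V) := by
          rw [lintegral_const_mul _ hdm.enorm, eLpNorm_one_eq_lintegral_enorm]
      _ ≤ ENNReal.ofReal H * (eLpNorm (fun ξ => w (x + δ • ξ) - w x) p (μ.restrict V) *
            μ V ^ (1 - 1 / p.toReal)) := by
          gcongr
          refine (eLpNorm_le_eLpNorm_mul_rpow_measure_univ hp hdm.aestronglyMeasurable).trans ?_
          rw [Measure.restrict_apply_univ, ENNReal.toReal_one, div_one]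
      _ = K * eLpNorm (fun ξ => w (x + δ • ξ) - w x) p (μ.restrict V) := by rw [hK]; ring
  calc eLpNorm (fun x => kernelAverage μ η δ w x - w x) p (μ.restrict S) ^ p.toReal
      = ∫⁻ x in S, ‖kernelAverage μ η δ w x - w x‖ₑ ^ p.toReal ∂μ := hpow _ _
    _ ≤ ∫⁻ x in S, K ^ p.toReal * ∫⁻ ξ in V, ‖w (x + δ • ξ) - w x‖ₑ ^ p.toReal ∂μ ∂μ :=
        lintegral_mono hpt
    _ = K ^ p.toReal * ∫⁻ x in S, ∫⁻ ξ in V, ‖w (x + δ • ξ) - w x‖ₑ ^ p.toReal ∂μ ∂μ :=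
        lintegral_const_mul _ hmeas.lintegral_prod_right'
    _ = K ^ p.toReal * ∫⁻ ξ in V, ∫⁻ x in S, ‖w (x + δ • ξ) - w x‖ₑ ^ p.toReal ∂μ ∂μ := by
        rw [lintegral_lintegral_swap hmeas.aemeasurable]
    _ = _ := by simp only [hpow]

/-! ### Local compactness -/

/-- Arzelà–Ascoli along an ultrafilter: a uniformly bounded family that is uniformly Lipschitz at
small distances is uniformly Cauchy on totally bounded sets. -/
theorem exists_mem_ultrafilter_norm_sub_le {ι X F : Type*} [PseudoMetricSpace X]
    [NormedAddCommGroup F] [ProperSpace F] (𝒰 : Ultrafilter ι) {f : ι → X → F} {S : Set X}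
    (hS : TotallyBounded S) {B δ : ℝ} (hδ : 0 < δ)
    (hf : ∀ᶠ i in (𝒰 : Filter ι), (∀ x, ‖f i x‖ ≤ B) ∧
      ∀ x y, dist x y ≤ δ → ‖f i x - f i y‖ ≤ B * dist x y) {κ : ℝ} (hκ : 0 < κ) :
    ∃ T ∈ 𝒰, ∀ i ∈ T, ∀ j ∈ T, ∀ x ∈ S, ‖f i x - f j x‖ ≤ κ := by
  have hlim : ∀ x, ∃ y, Tendsto (fun i => f i x) 𝒰 (𝓝 y) := by
    intro x
    obtain ⟨y, -, hy⟩ := (isCompact_closedBall (0 : F) B).ultrafilter_le_nhds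
      (𝒰.map fun i => f i x) (by
        rw [le_principal_iff]
        have h : ∀ᶠ i in (𝒰 : Filter ι), f i x ∈ Metric.closedBall 0 B :=
          hf.mono fun i hi => by simpa using hi.1 x
        exact h)
    exact ⟨y, hy⟩
  choose g hg using hlim
  set δ' := min δ (κ / (4 * (|B| + 1))) with hδ'
  have hδ'0 : 0 < δ' := lt_min hδ (by positivity)
  obtain ⟨c, hc, hcov⟩ := Metric.totallyBounded_iff.1 hS δ' hδ'0
  have hc' : ∀ᶠ i in (𝒰 : Filter ι), ∀ y ∈ c, dist (f i y) (g y) < κ / 4 :=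
    (eventually_all_finite hc).2 fun y _ => (hg y).eventually (Metric.ball_mem_nhds _ (by positivity))
  refine ⟨_, hf.and hc', fun i hi j hj x hx => ?_⟩
  obtain ⟨y, hy, hxy⟩ : ∃ y ∈ c, dist x y < δ' := by simpa using hcov hx
  have hB : B * dist x y ≤ κ / 4 := by
    calc B * dist x y ≤ |B| * (κ / (4 * (|B| + 1))) := by
          gcongr
          · exact le_abs_self B
          · exact hxy.le.trans (min_le_right _ _)
      _ ≤ κ / 4 := by
          rw [mul_div_assoc', div_le_div_iff₀ (by positivity) (by norm_num)]
          nlinarith [abs_nonneg B]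
  have hxyδ : dist x y ≤ δ := hxy.le.trans (min_le_left _ _)
  have h1 := (hi.1.2 x y hxyδ).trans hB
  have h2 := (hj.1.2 x y hxyδ).trans hB
  have h3 := hi.2 y hy
  have h4 := hj.2 y hy
  rw [← dist_eq_norm] at h1 h2 ⊢
  have h5 := dist_triangle (f i x) (f i y) (f j x)
  have h6 := dist_triangle (f i y) (g y) (f j x)
  have h7 := dist_triangle (g y) (f j y) (f j x)
  rw [dist_comm (g y) (f j y), dist_comm (f j y) (f j x)] at h7
  linarith

/-- The sequence `w` is Cauchy in `L^p(S)` along the ultrafilter `𝒰`. -/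
def CauchyAlong {E F : Type*} [MeasurableSpace E] [NormedAddCommGroup F] (μ : Measure E)
    (p : ℝ≥0∞) (𝒰 : Ultrafilter ℕ) (w : ℕ → E → F) (S : Set E) : Prop :=
  ∀ κ : ℝ≥0∞, κ ≠ 0 → ∃ T ∈ 𝒰, ∀ i ∈ T, ∀ j ∈ T, eLpNorm (w i - w j) p (μ.restrict S) ≤ κ

/-- Local compactness. The average of `w j` at scale `N_j ε_j ≈ δ` is `O(δ)`-close to `w j` in
`L^p(S)` by telescoping, and for fixed `δ` such averages are relatively compact. -/
theorem cauchyAlong_of_uniform_cone {E F : Type*} [NormedAddCommGroup E]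
    [NormedSpace ℝ E] [MeasurableSpace E] [BorelSpace E] [FiniteDimensional ℝ E] (μ : Measure E)
    [μ.IsAddHaarMeasure] [NormedAddCommGroup F] [NormedSpace ℝ F] [FiniteDimensional ℝ F]
    {p : ℝ≥0∞} (hp : 1 ≤ p) (hp_top : p ≠ ∞) {A S : Set E} (hA : IsOpen A)
    (hSm : MeasurableSet S) (hS : Bornology.IsBounded S) {r : ℝ} {ξ₀ : E} {s δ₀ : ℝ}
    (hs : 0 < s) (hδ₀ : 0 < δ₀)
    (hball : Metric.ball ξ₀ s ⊆ Metric.ball 0 r)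
    (hcone : ∀ x ∈ S, ∀ ξ ∈ Metric.ball ξ₀ s, ∀ t ∈ Set.Icc 0 δ₀, x + t • ξ ∈ A)
    {w : ℕ → E → F} (hw : ∀ j, StronglyMeasurable (w j)) {C : ℝ≥0∞} (hC : C ≠ ∞)
    (hwC : ∀ j, eLpNorm (w j) p μ ≤ C) {ε : ℕ → ℝ} (hε_pos : ∀ j, 0 < ε j)
    (hε : Tendsto ε atTop (𝓝 0))
    (hG : ∀ j, ∫⁻ ξ in Metric.ball 0 r, eLpNorm (fun x => w j (x + ε j • ξ) - w j x) p
      (μ.restrict (shiftSet A (ε j) ξ)) ^ p.toReal ∂μ ≤ (ENNReal.ofReal (ε j) * C) ^ p.toReal)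
    {𝒰 : Ultrafilter ℕ} (h𝒰 : (𝒰 : Filter ℕ) ≤ atTop) : CauchyAlong μ p 𝒰 w S := by
  have hpropE : ProperSpace E := FiniteDimensional.proper ℝ E
  have hpropF : ProperSpace F := FiniteDimensional.proper ℝ F
  have hcompF : CompleteSpace F := FiniteDimensional.complete ℝ F
  have hp0 : p ≠ 0 := (zero_lt_one.trans_le hp).ne'
  have hq : 0 < p.toReal := ENNReal.toReal_pos hp0 hp_top
  have hq1 : 1 ≤ p.toReal := by
    rw [← ENNReal.toReal_one]
    exact (ENNReal.toReal_le_toReal (by simp) hp_top).2 hp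
  obtain ⟨η, H, L, hη0, hηH, hηL, hsupp, hη1⟩ := exists_lipschitz_density μ ξ₀ hs
  set K := ENNReal.ofReal H * μ (Metric.ball ξ₀ s) ^ (1 - 1 / p.toReal) with hK
  have hK_top : K ≠ ∞ := by
    refine ENNReal.mul_ne_top ENNReal.ofReal_ne_top
      (ENNReal.rpow_ne_top_of_nonneg ?_ measure_ball_lt_top.ne)
    rw [sub_nonneg, div_le_one hq]
    exact hq1
  have hclose : ∀ (j N : ℕ), 0 < N → N * ε j ≤ δ₀ →
      eLpNorm (fun x => kernelAverage μ η (N * ε j) (w j) x - w j x) p (μ.restrict S) ≤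
        K * (ENNReal.ofReal (N * ε j) * C) := by
    intro j N hN hNε
    have hpos : 0 < N * ε j := mul_pos (by exact_mod_cast hN) (hε_pos j)
    rw [← ENNReal.rpow_le_rpow_iff hq, ENNReal.mul_rpow_of_nonneg _ _ hq.le]
    refine (eLpNorm_kernelAverage_sub_rpow_le μ hp hp_top hpos hη0 hηH hηL hsupp hη1 (hw j)
      (ne_top_of_le_ne_top hC (hwC j)) S).trans ?_
    gcongr
    calc ∫⁻ ξ in Metric.ball ξ₀ s, eLpNorm (fun x => w j (x + (N * ε j) • ξ) - w j x) p
          (μ.restrict S) ^ p.toReal ∂μ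
        ≤ ∫⁻ ξ in Metric.ball ξ₀ s, (N : ℝ≥0∞) ^ p.toReal *
          eLpNorm (fun x => w j (x + ε j • ξ) - w j x) p
            (μ.restrict (shiftSet A (ε j) ξ)) ^ p.toReal ∂μ := by
          refine setLIntegral_mono' measurableSet_ball fun ξ hξ => ?_
          rw [← ENNReal.mul_rpow_of_nonneg _ _ hq.le]
          refine ENNReal.rpow_le_rpow ?_ hq.le
          refine eLpNorm_shift_sub_le_nat_mul μ hp hA (hw j) (ε j) ξ N fun x hx i hi => ?_
          refine hcone x hx ξ hξ _ ⟨by have := hε_pos j; positivity, le_trans ?_ hNε⟩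
          have := (hε_pos j).le
          gcongr
      _ = (N : ℝ≥0∞) ^ p.toReal * ∫⁻ ξ in Metric.ball ξ₀ s,
          eLpNorm (fun x => w j (x + ε j • ξ) - w j x) p
            (μ.restrict (shiftSet A (ε j) ξ)) ^ p.toReal ∂μ :=
          lintegral_const_mul' _ _ (ENNReal.rpow_ne_top_of_nonneg hq.le (by simp))
      _ ≤ (N : ℝ≥0∞) ^ p.toReal * (ENNReal.ofReal (ε j) * C) ^ p.toReal := by
          gcongr
          exact (lintegral_mono_set hball).trans (hG j)
      _ = (ENNReal.ofReal (N * ε j) * C) ^ p.toReal := by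
          rw [← ENNReal.mul_rpow_of_nonneg _ _ hq.le, ENNReal.ofReal_mul (by positivity),
            ENNReal.ofReal_natCast, mul_assoc]
  intro κ hκ
  wlog hκ_top : κ ≠ ∞ generalizing κ
  · obtain ⟨T, hT, h⟩ := this 1 one_ne_zero ENNReal.one_ne_top
    rw [not_not.1 hκ_top]
    exact ⟨T, hT, fun _ _ _ _ => le_top⟩
  have hκ3 : κ / 3 ≠ 0 := by simpa using hκ
  obtain ⟨δ, hδ0, hδδ₀, hδκ⟩ : ∃ δ : ℝ, 0 < δ ∧ δ ≤ δ₀ ∧ K * (ENNReal.ofReal δ * C) ≤ κ / 3 := by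
    have hlim : Tendsto (fun t : ℝ => K * (ENNReal.ofReal t * C)) (𝓝[>] 0)
        (𝓝 (K * (ENNReal.ofReal 0 * C))) := by
      refine Tendsto.mono_left ?_ nhdsWithin_le_nhds
      exact ENNReal.Tendsto.const_mul (ENNReal.Tendsto.mul_const
        (ENNReal.continuous_ofReal.tendsto 0) (Or.inr hC)) (Or.inr hK_top)
    rw [ENNReal.ofReal_zero, zero_mul, mul_zero] at hlim
    have h1 := hlim.eventually_le_const (pos_iff_ne_zero.2 hκ3)
    have h2 : ∀ᶠ t : ℝ in 𝓝[>] 0, t ≤ δ₀ :=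
      nhdsWithin_le_nhds (eventually_le_nhds hδ₀)
    obtain ⟨t, ⟨ht1, ht2⟩, ht3⟩ := ((h1.and h2).and self_mem_nhdsWithin).exists
    exact ⟨t, ht3, ht2, ht1⟩
  obtain ⟨B, hB0, hB⟩ := exists_kernelAverage_bound_lipschitz (F := F) μ hp hp_top hC
    (half_pos hδ0) hη0 hηH hηL hsupp
  -- the number of steps of size `ε j` for which the scale `N j * ε j` lies in `[δ / 2, δ]`
  let N : ℕ → ℕ := fun j => ⌊δ / ε j⌋₊
  have hN : ∀ᶠ j in (𝒰 : Filter ℕ), 0 < N j ∧ N j * ε j ≤ δ ∧ δ / 2 ≤ N j * ε j := by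
    refine h𝒰 ?_
    filter_upwards [hε.eventually_le_const (half_pos hδ0)] with j hj
    have hpos := hε_pos j
    have h1 : (N j : ℝ) ≤ δ / ε j := Nat.floor_le (by positivity)
    have h2 : δ / ε j < N j + 1 := Nat.lt_floor_add_one _
    rw [le_div_iff₀ hpos] at h1
    rw [div_lt_iff₀ hpos] at h2
    have h3 : δ / 2 ≤ N j * ε j := by linarith
    refine ⟨?_, h1, h3⟩
    have h4 : (0 : ℝ) < N j := by
      by_contra h
      have : (N j : ℝ) * ε j ≤ 0 := mul_nonpos_of_nonpos_of_nonneg (not_lt.1 h) hpos.le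
      linarith
    exact_mod_cast h4
  set m : ℕ → E → F := fun j => kernelAverage μ η (N j * ε j) (w j) with hm
  have hmlip : ∀ᶠ j in (𝒰 : Filter ℕ), (∀ x, ‖m j x‖ ≤ B) ∧
      ∀ x y, dist x y ≤ δ / 2 → ‖m j x - m j y‖ ≤ B * dist x y := by
    filter_upwards [hN] with j hj
    have h := hB (w j) (hw j) (hwC j) _ hj.2.2
    exact ⟨h.1, fun x y hxy => by rw [dist_eq_norm] at hxy ⊢; exact h.2 x y hxy⟩
  -- on the bounded set `S`, a uniform bound `κ'` yields the bound `κ / 3` in `L^p`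
  obtain ⟨κ', hκ'0, hκ'⟩ : ∃ κ' : ℝ, 0 < κ' ∧
      μ S ^ p.toReal⁻¹ * ENNReal.ofReal κ' ≤ κ / 3 := by
    have hlim : Tendsto (fun t : ℝ => μ S ^ p.toReal⁻¹ * ENNReal.ofReal t) (𝓝[>] 0)
        (𝓝 (μ S ^ p.toReal⁻¹ * ENNReal.ofReal 0)) := by
      refine Tendsto.mono_left ?_ nhdsWithin_le_nhds
      refine ENNReal.Tendsto.const_mul (ENNReal.continuous_ofReal.tendsto 0) (Or.inr ?_)
      exact ENNReal.rpow_ne_top_of_nonneg (by positivity) hS.measure_lt_top.ne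
    rw [ENNReal.ofReal_zero, mul_zero] at hlim
    obtain ⟨t, ht1, ht2⟩ := ((hlim.eventually_le_const (pos_iff_ne_zero.2 hκ3)).and
      self_mem_nhdsWithin).exists
    exact ⟨t, ht2, ht1⟩
  obtain ⟨T, hT, hTm⟩ := exists_mem_ultrafilter_norm_sub_le 𝒰
    (hS.isCompact_closure.totallyBounded.subset subset_closure)
    (half_pos hδ0) hmlip hκ'0
  refine ⟨_, inter_mem (inter_mem hT hN) hmlip, fun i hi j hj => ?_⟩
  have hmc : ∀ k, ((∀ x, ‖m k x‖ ≤ B) ∧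
      ∀ x y, dist x y ≤ δ / 2 → ‖m k x - m k y‖ ≤ B * dist x y) → StronglyMeasurable (m k) := by
    intro k hk
    refine Continuous.stronglyMeasurable (Metric.continuous_iff.2 fun x e he => ?_)
    refine ⟨min (δ / 2) (e / (B + 1)), by positivity, fun y hy => ?_⟩
    rw [dist_eq_norm]
    refine (hk.2 y x (hy.le.trans (min_le_left _ _))).trans_lt ?_
    have h1 : dist y x < e / (B + 1) := hy.trans_le (min_le_right _ _)
    rw [lt_div_iff₀ (by positivity)] at h1
    nlinarith [dist_nonneg (x := y) (y := x)]
  have hdist : ∀ k, k ∈ {k | 0 < N k ∧ N k * ε k ≤ δ ∧ δ / 2 ≤ N k * ε k} →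
      eLpNorm (fun x => m k x - w k x) p (μ.restrict S) ≤ κ / 3 := by
    intro k hk
    refine (hclose k (N k) hk.1 (hk.2.1.trans hδδ₀)).trans (le_trans ?_ hδκ)
    gcongr
    exact hk.2.1
  have hmid : eLpNorm (fun x => m i x - m j x) p (μ.restrict S) ≤ κ / 3 := by
    refine le_trans ?_ hκ'
    rw [← Measure.restrict_apply_univ]
    refine eLpNorm_le_of_ae_bound ((ae_restrict_iff' hSm).2 (ae_of_all _ fun x hx => ?_))
    exact hTm i hi.1.1 j hj.1.1 x hx
  have hsplit : w i - w j = ((fun x => m i x - m j x) - (fun x => m i x - w i x)) +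
      fun x => m j x - w j x := by
    funext x
    simp only [Pi.sub_apply, Pi.add_apply]
    abel
  have hmi := hmc i hi.2
  have hmj := hmc j hj.2
  rw [hsplit]
  calc _ ≤ eLpNorm ((fun x => m i x - m j x) - fun x => m i x - w i x) p (μ.restrict S) +
        eLpNorm (fun x => m j x - w j x) p (μ.restrict S) :=
        eLpNorm_add_le (((hmi.sub hmj).sub (hmi.sub (hw i))).aestronglyMeasurable)
          ((hmj.sub (hw j)).aestronglyMeasurable) hp
    _ ≤ (κ / 3 + κ / 3) + κ / 3 := by
        gcongr
        · refine (eLpNorm_sub_le (hmi.sub hmj).aestronglyMeasurable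
            (hmi.sub (hw i)).aestronglyMeasurable hp).trans ?_
          exact add_le_add hmid (hdist i hi.1.2)
        · exact hdist j hj.1.2
    _ = κ := ENNReal.add_thirds κ

/-! ### Global compactness -/

theorem CauchyAlong.mono {E F : Type*} [MeasurableSpace E] [NormedAddCommGroup F] {μ : Measure E}
    {p : ℝ≥0∞} {𝒰 : Ultrafilter ℕ} {w : ℕ → E → F} {S S' : Set E} (h : CauchyAlong μ p 𝒰 w S')
    (hSS' : S ⊆ S') : CauchyAlong μ p 𝒰 w S := fun κ hκ => by
  obtain ⟨T, hT, hle⟩ := h κ hκ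
  exact ⟨T, hT, fun i hi j hj =>
    (eLpNorm_mono_measure _ (Measure.restrict_mono hSS' le_rfl)).trans (hle i hi j hj)⟩

theorem eLpNorm_restrict_union_le {E F : Type*} [MeasurableSpace E] [NormedAddCommGroup F]
    (μ : Measure E) {p : ℝ≥0∞} (hp : 1 ≤ p) (hp_top : p ≠ ∞) (f : E → F) (S S' : Set E) :
    eLpNorm f p (μ.restrict (S ∪ S')) ≤
      eLpNorm f p (μ.restrict S) + eLpNorm f p (μ.restrict S') := by
  have hp0 : p ≠ 0 := (zero_lt_one.trans_le hp).ne'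
  have hq : 0 < p.toReal := ENNReal.toReal_pos hp0 hp_top
  have hq1 : 1 ≤ p.toReal := by
    rw [← ENNReal.toReal_one]
    exact (ENNReal.toReal_le_toReal (by simp) hp_top).2 hp
  simp only [eLpNorm_eq_lintegral_rpow_enorm_toReal hp0 hp_top]
  calc _ ≤ ((∫⁻ x in S, ‖f x‖ₑ ^ p.toReal ∂μ) + ∫⁻ x in S', ‖f x‖ₑ ^ p.toReal ∂μ) ^
        (1 / p.toReal) := by
        gcongr
        exact lintegral_union_le _ _ _
    _ ≤ _ := ENNReal.rpow_add_le_add_rpow _ _ (by positivity) (by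
        rw [div_le_one hq]; exact hq1)

theorem CauchyAlong.union {E F : Type*} [MeasurableSpace E] [NormedAddCommGroup F] {μ : Measure E}
    {p : ℝ≥0∞} (hp : 1 ≤ p) (hp_top : p ≠ ∞) {𝒰 : Ultrafilter ℕ} {w : ℕ → E → F} {S S' : Set E}
    (h : CauchyAlong μ p 𝒰 w S) (h' : CauchyAlong μ p 𝒰 w S') :
    CauchyAlong μ p 𝒰 w (S ∪ S') := fun κ hκ => by
  have hκ2 : κ / 2 ≠ 0 := by simpa using hκ
  obtain ⟨T, hT, hle⟩ := h (κ / 2) hκ2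
  obtain ⟨T', hT', hle'⟩ := h' (κ / 2) hκ2
  refine ⟨T ∩ T', inter_mem hT hT', fun i hi j hj => ?_⟩
  refine (eLpNorm_restrict_union_le μ hp hp_top _ _ _).trans ?_
  exact (add_le_add (hle i hi.1 j hj.1) (hle' i hi.2 j hj.2)).trans_eq (ENNReal.add_halves κ)

theorem cauchyAlong_empty {E F : Type*} [MeasurableSpace E] [NormedAddCommGroup F] (μ : Measure E)
    (p : ℝ≥0∞) (𝒰 : Ultrafilter ℕ) (w : ℕ → E → F) : CauchyAlong μ p 𝒰 w ∅ :=
  fun κ _ => ⟨Set.univ, univ_mem, fun i _ j _ => by simp⟩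

/-- Gluing: if the tails of `w` are uniformly small, local Cauchy estimates near the points of the
closure of `A` yield a Cauchy estimate on all of `A`. -/
theorem cauchyAlong_of_locally {E F : Type*} [NormedAddCommGroup E] [ProperSpace E]
    [MeasurableSpace E] [NormedAddCommGroup F] {μ : Measure E} {p : ℝ≥0∞} (hp : 1 ≤ p)
    (hp_top : p ≠ ∞) {A : Set E} {w : ℕ → E → F} (hw : ∀ j, StronglyMeasurable (w j))
    {𝒰 : Ultrafilter ℕ}
    (hloc : ∀ x₀ ∈ closure A, ∃ ρ : ℝ, 0 < ρ ∧ CauchyAlong μ p 𝒰 w (A ∩ Metric.ball x₀ ρ))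
    (htails : ∀ κ : ℝ≥0∞, κ ≠ 0 → ∃ R : ℝ, ∀ j,
      eLpNorm (w j) p (μ.restrict (A \ Metric.ball 0 R)) ≤ κ) :
    CauchyAlong μ p 𝒰 w A := by
  have hbdd : ∀ R : ℝ, CauchyAlong μ p 𝒰 w (A ∩ Metric.ball 0 R) := by
    intro R
    have hcomp : IsCompact (closure A ∩ Metric.closedBall 0 R) :=
      (isCompact_closedBall 0 R).inter_left isClosed_closure
    have key : CauchyAlong μ p 𝒰 w (A ∩ (closure A ∩ Metric.closedBall 0 R)) := by
      refine hcomp.induction_on (p := fun s => CauchyAlong μ p 𝒰 w (A ∩ s)) ?_ ?_ ?_ ?_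
      · simpa using cauchyAlong_empty μ p 𝒰 w
      · exact fun s t hst h => h.mono (Set.inter_subset_inter_right A hst)
      · intro s t hs ht
        rw [Set.inter_union_distrib_left]
        exact hs.union hp hp_top ht
      · intro x hx
        obtain ⟨ρ, hρ, h⟩ := hloc x hx.1
        exact ⟨_, mem_nhdsWithin_of_mem_nhds (Metric.ball_mem_nhds x hρ), h⟩
    exact key.mono fun x hx => ⟨hx.1, subset_closure hx.1, Metric.ball_subset_closedBall hx.2⟩
  intro κ hκ
  have hκ2 : κ / 2 ≠ 0 := by simpa using hκ
  have hκ4 : κ / 2 / 2 ≠ 0 := by simpa using hκ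
  obtain ⟨R, hR⟩ := htails (κ / 2 / 2) hκ4
  obtain ⟨T, hT, hle⟩ := hbdd R (κ / 2) hκ2
  refine ⟨T, hT, fun i hi j hj => ?_⟩
  rw [← Set.inter_union_sdiff A (Metric.ball 0 R)]
  refine (eLpNorm_restrict_union_le μ hp hp_top _ _ _).trans ?_
  calc _ ≤ κ / 2 + (κ / 2 / 2 + κ / 2 / 2) := by
        refine add_le_add (hle i hi j hj) ?_
        exact (eLpNorm_sub_le (hw i).aestronglyMeasurable (hw j).aestronglyMeasurable hp).trans
          (add_le_add (hR i) (hR j))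
    _ = κ := by rw [ENNReal.add_halves, ENNReal.add_halves]

/-- A sequence in a complete space that is Cauchy along every free ultrafilter has relatively
compact range. -/
theorem isCompact_closure_range_of_ultrafilter {X : Type*} [PseudoMetricSpace X] [CompleteSpace X]
    (x : ℕ → X) (h : ∀ 𝒰 : Ultrafilter ℕ, (𝒰 : Filter ℕ) ≤ atTop → ∀ κ : ℝ≥0∞, κ ≠ 0 →
      ∃ T ∈ 𝒰, ∀ i ∈ T, ∀ j ∈ T, edist (x i) (x j) ≤ κ) :
    IsCompact (closure (Set.range x)) := by
  refine isCompact_iff_totallyBounded_isComplete.2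
    ⟨TotallyBounded.closure ?_, isClosed_closure.isComplete⟩
  rw [totallyBounded_iff_ultrafilter]
  intro f hf
  have hne : (comap x (f : Filter X)).NeBot := by
    refine comap_neBot fun t ht => ?_
    obtain ⟨y, hyt, k, rfl⟩ := f.neBot.nonempty_of_mem (inter_mem ht (le_principal_iff.1 hf))
    exact ⟨k, hyt⟩
  set 𝒰 := Ultrafilter.of (comap x (f : Filter X)) with h𝒰
  have hmap : map x (𝒰 : Filter ℕ) = f :=
    f.unique ((map_mono (Ultrafilter.of_le _)).trans map_comap_le)
  rw [← hmap, EMetric.cauchy_iff]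
  refine ⟨(𝒰.neBot.map x).ne, fun κ hκ => ?_⟩
  -- along a principal ultrafilter the sequence is eventually constant
  rcases 𝒰.le_cofinite_or_eq_pure with h1 | ⟨k, hk⟩
  · obtain ⟨κ', hκ'0, hκ'⟩ := exists_between hκ
    obtain ⟨T, hT, hle⟩ := h 𝒰 (h1.trans_eq Nat.cofinite_eq_atTop) κ' hκ'0.ne'
    refine ⟨x '' T, image_mem_map hT, ?_⟩
    rintro _ ⟨i, hi, rfl⟩ _ ⟨j, hj, rfl⟩
    exact (hle i hi j hj).trans_lt hκ'
  · refine ⟨{x k}, ?_, ?_⟩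
    · rw [hk, Ultrafilter.coe_pure, Filter.map_pure]
      exact mem_pure.2 rfl
    · rintro _ rfl _ rfl
      simpa using hκ

/-! ### Weak derivatives of the limit -/

/-- `g` is the weak derivative of `v` in the direction `ξ` in the open set `A`. -/
def HasWeakDirDeriv {E F : Type*} [NormedAddCommGroup E] [NormedSpace ℝ E] [MeasurableSpace E]
    [NormedAddCommGroup F] [NormedSpace ℝ F] (μ : Measure E) (A : Set E) (v : E → F) (ξ : E)
    (g : E → F) : Prop :=
  ∀ φ : E → ℝ, ContDiff ℝ (⊤ : ℕ∞) φ → HasCompactSupport φ → tsupport φ ⊆ A →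
    ∫ x in A, fderiv ℝ φ x ξ • v x ∂μ = -∫ x in A, φ x • g x ∂μ

/-- The difference quotient of `w` in the direction `ξ`, extended by zero to the points `x` for
which `x` or `x + ε ξ` is outside `A`. -/
noncomputable def differenceQuotient {E F : Type*} [NormedAddCommGroup E] [NormedSpace ℝ E]
    [NormedAddCommGroup F] [NormedSpace ℝ F] (A : Set E) (ε : ℝ) (ξ : E) (w : E → F) : E → F :=
  (shiftSet A ε ξ).indicator fun x => ε⁻¹ • (w (x + ε • ξ) - w x)

theorem stronglyMeasurable_differenceQuotient {E F : Type*} [NormedAddCommGroup E]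
    [NormedSpace ℝ E] [MeasurableSpace E] [BorelSpace E] [NormedAddCommGroup F] [NormedSpace ℝ F]
    {A : Set E} (hA : IsOpen A) (ε : ℝ) (ξ : E) {w : E → F} (hw : StronglyMeasurable w) :
    StronglyMeasurable (differenceQuotient A ε ξ w) := by
  refine StronglyMeasurable.indicator ?_ (isOpen_shiftSet hA ε ξ).measurableSet
  exact ((hw.comp_measurable (g := fun x : E => x + ε • ξ)
    ((continuous_id.add continuous_const).measurable)).sub hw).const_smul _

/-- Discrete integration by parts. -/
theorem integral_smul_differenceQuotient {E F : Type*} [NormedAddCommGroup E]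
    [NormedSpace ℝ E] [MeasurableSpace E] [BorelSpace E] {μ : Measure E} [μ.IsAddRightInvariant]
    [NormedAddCommGroup F] [NormedSpace ℝ F] {A : Set E} {ε : ℝ} {ξ : E} {w : E → F}
    (hw : LocallyIntegrable w μ) {φ : E → ℝ} (hφ : Continuous φ) (hφc : HasCompactSupport φ)
    (hφA : ∀ x ∈ tsupport φ, x ∈ shiftSet A ε ξ) :
    ∫ x, φ x • differenceQuotient A ε ξ w x ∂μ =
      ∫ x, (ε⁻¹ * (φ (x - ε • ξ) - φ x)) • w x ∂μ := by
  have h1 : Integrable (fun x => φ x • w x) μ :=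
    hw.integrable_smul_left_of_hasCompactSupport hφ hφc
  have h2 : Integrable (fun x => φ (x - ε • ξ) • w x) μ := by
    refine hw.integrable_smul_left_of_hasCompactSupport (hφ.comp (continuous_sub_right _)) ?_
    exact hφc.comp_homeomorph (Homeomorph.subRight (ε • ξ))
  have h3 : Integrable (fun x => φ x • w (x + ε • ξ)) μ := by
    have := h2.comp_add_right (ε • ξ)
    simpa using this
  have h4 : ∫ x, φ x • w (x + ε • ξ) ∂μ = ∫ x, φ (x - ε • ξ) • w x ∂μ := by
    rw [← integral_add_right_eq_self (fun x => φ (x - ε • ξ) • w x) (ε • ξ)]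
    simp
  calc ∫ x, φ x • differenceQuotient A ε ξ w x ∂μ
      = ∫ x, ε⁻¹ • (φ x • w (x + ε • ξ) - φ x • w x) ∂μ := by
        refine integral_congr_ae (ae_of_all _ fun x => ?_)
        by_cases hx : x ∈ tsupport φ
        · simp only [differenceQuotient, Set.indicator_of_mem (hφA x hx)]
          rw [smul_comm, smul_sub]
        · simp [image_eq_zero_of_notMem_tsupport hx]
    _ = ∫ x, ε⁻¹ • (φ (x - ε • ξ) • w x - φ x • w x) ∂μ := by
        rw [integral_smul, integral_smul, integral_sub h3 h1, integral_sub h2 h1, h4]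
    _ = _ := by simp only [mul_smul, sub_smul]

/-- The difference quotients of a sequence that converges in `L^p` converge to the directional
derivative of the limit in the sense of distributions. -/
theorem tendsto_integral_smul_differenceQuotient {E F : Type*} [NormedAddCommGroup E]
    [NormedSpace ℝ E] [MeasurableSpace E] [BorelSpace E] [FiniteDimensional ℝ E] (μ : Measure E)
    [μ.IsAddHaarMeasure] [NormedAddCommGroup F] [NormedSpace ℝ F] {p : ℝ≥0∞} (hp : 1 ≤ p)
    (hp_top : p ≠ ∞) {A : Set E} (hA : IsOpen A) {w : ℕ → E → F} {v : E → F}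
    (hw : ∀ k, MemLp (w k) p μ) (hv : MemLp v p μ)
    (hwv : Tendsto (fun k => eLpNorm (w k - v) p μ) atTop (𝓝 0)) {ε : ℕ → ℝ}
    (hε_pos : ∀ k, 0 < ε k) (hε : Tendsto ε atTop (𝓝 0)) (ξ : E) {φ : E → ℝ}
    (hφ : ContDiff ℝ (⊤ : ℕ∞) φ) (hφc : HasCompactSupport φ) (hφA : tsupport φ ⊆ A) :
    Tendsto (fun k => ∫ x, φ x • differenceQuotient A (ε k) ξ (w k) x ∂μ) atTop
      (𝓝 (-∫ x, fderiv ℝ φ x ξ • v x ∂μ)) := by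
  have hprop : ProperSpace E := FiniteDimensional.proper ℝ E
  have hq : 1 ≤ p.toReal := by
    rw [← ENNReal.toReal_one]
    exact (ENNReal.toReal_le_toReal (by simp) hp_top).2 hp
  obtain ⟨δ, hδ, hδA⟩ := hφc.isCompact.exists_thickening_subset_open hA hφA
  obtain ⟨L, hL⟩ := hφ.lipschitzWith_of_hasCompactSupport hφc (by simp)
  set W := Metric.cthickening 1 (tsupport φ) with hW
  have hWc : IsCompact W := hφc.isCompact.cthickening
  have hWfin : μ W ≠ ∞ := hWc.measure_lt_top.ne
  set D : ℕ → E → ℝ := fun k x => (ε k)⁻¹ * (φ (x - ε k • ξ) - φ x) with hD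
  have hnorm : Tendsto (fun k => ‖ε k • ξ‖) atTop (𝓝 0) := by
    have := (hε.smul_const ξ).norm
    simpa using this
  have hlarge : ∀ᶠ k in atTop, ‖ε k • ξ‖ < δ ∧ ‖ε k • ξ‖ < 1 :=
    (hnorm.eventually_lt_const hδ).and (hnorm.eventually_lt_const one_pos)
  have hDm : ∀ k, Measurable (D k) := fun k =>
    (continuous_const.mul ((hφ.continuous.comp (continuous_sub_right _)).sub
      hφ.continuous)).measurable
  have hDL : ∀ k x, ‖D k x‖ ≤ L * ‖ξ‖ := by
    intro k x
    have hk := hε_pos k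
    have h1 := hL.dist_le_mul (x - ε k • ξ) x
    rw [dist_eq_norm, dist_eq_norm, sub_sub_cancel_left, norm_neg, norm_smul,
      Real.norm_of_nonneg hk.le] at h1
    rw [hD, norm_mul, norm_inv, Real.norm_of_nonneg hk.le]
    rw [inv_mul_le_iff₀ hk]
    linarith
  have hDsupp : ∀ k, ‖ε k • ξ‖ < 1 → ∀ x, x ∉ W → D k x = 0 := by
    intro k hk x hx
    have h1 : x ∉ tsupport φ := fun h => hx (Metric.self_subset_cthickening _ h)
    have h2 : x - ε k • ξ ∉ tsupport φ := by
      intro h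
      refine hx (Metric.mem_cthickening_of_dist_le x _ 1 _ h ?_)
      rw [dist_eq_norm, sub_sub_cancel]
      exact hk.le
    simp [hD, image_eq_zero_of_notMem_tsupport h1, image_eq_zero_of_notMem_tsupport h2]
  have hloc : ∀ f : E → F, MemLp f p μ → LocallyIntegrable f μ := fun f hf =>
    hf.locallyIntegrable hp
  have hWint : ∀ f : E → F, MemLp f p μ → IntegrableOn f W μ := fun f hf =>
    (hloc f hf).integrableOn_isCompact hWc
  have heq : ∀ᶠ k in atTop, ∫ x, φ x • differenceQuotient A (ε k) ξ (w k) x ∂μ =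
      ∫ x, D k x • (w k - v) x ∂μ + ∫ x, D k x • v x ∂μ := by
    filter_upwards [hlarge] with k hk
    rw [integral_smul_differenceQuotient (hloc _ (hw k)) hφ.continuous hφc]
    · rw [← integral_add
        (integrable_kernel_smul (hDm k) (hDL k) (hDsupp k hk.2) (hWint _ ((hw k).sub hv))).1
        (integrable_kernel_smul (hDm k) (hDL k) (hDsupp k hk.2) (hWint _ hv)).1]
      refine integral_congr_ae (ae_of_all _ fun x => ?_)
      simp only [← smul_add, Pi.sub_apply, sub_add_cancel, hD]
    · intro x hx
      refine ⟨hφA hx, hδA (Metric.mem_thickening_iff.2 ⟨x, hx, ?_⟩)⟩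
      rw [dist_eq_norm, add_sub_cancel_left]
      exact hk.1
  rw [tendsto_congr' heq]
  have hfirst : Tendsto (fun k => ∫ x, D k x • (w k - v) x ∂μ) atTop (𝓝 0) := by
    have hbound : ∀ᶠ k in atTop, ‖∫ x, D k x • (w k - v) x ∂μ‖ ≤
        L * ‖ξ‖ * (eLpNorm (w k - v) p μ * μ W ^ (1 - 1 / p.toReal)).toReal := by
      filter_upwards [hlarge] with k hk
      have hm := (hw k).sub hv
      refine (integrable_kernel_smul (hDm k) (hDL k) (hDsupp k hk.2) (hWint _ hm)).2.trans ?_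
      gcongr
      rw [integral_norm_eq_lintegral_enorm hm.aestronglyMeasurable.restrict,
        ← eLpNorm_one_eq_lintegral_enorm]
      refine ENNReal.toReal_mono (ENNReal.mul_ne_top hm.eLpNorm_ne_top
        (ENNReal.rpow_ne_top_of_nonneg ?_ hWfin)) ?_
      · rw [sub_nonneg, div_le_one (by linarith)]; exact hq
      · refine (eLpNorm_le_eLpNorm_mul_rpow_measure_univ hp
          hm.aestronglyMeasurable.restrict).trans ?_
        rw [Measure.restrict_apply_univ, ENNReal.toReal_one, div_one]
        gcongr
        exact Measure.restrict_le_self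
    refine squeeze_zero_norm' hbound ?_
    have h1 : Tendsto (fun k => eLpNorm (w k - v) p μ * μ W ^ (1 - 1 / p.toReal)) atTop
        (𝓝 (0 * μ W ^ (1 - 1 / p.toReal))) :=
      ENNReal.Tendsto.mul_const hwv (Or.inr (ENNReal.rpow_ne_top_of_nonneg (by
        rw [sub_nonneg, div_le_one (by linarith)]; exact hq) hWfin))
    rw [zero_mul] at h1
    have h2 := ((ENNReal.tendsto_toReal ENNReal.zero_ne_top).comp h1).const_mul (L * ‖ξ‖)
    simpa using h2
  have hsecond : Tendsto (fun k => ∫ x, D k x • v x ∂μ) atTop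
      (𝓝 (∫ x, (-fderiv ℝ φ x ξ) • v x ∂μ)) := by
    refine tendsto_integral_filter_of_dominated_convergence
      (fun x => W.indicator (fun x => L * ‖ξ‖ * ‖v x‖) x)
      (Eventually.of_forall fun k => (hDm k).aestronglyMeasurable.smul hv.aestronglyMeasurable)
      ?_ ?_ ?_
    · filter_upwards [hlarge] with k hk
      refine ae_of_all _ fun x => ?_
      by_cases hx : x ∈ W
      · rw [Set.indicator_of_mem hx, norm_smul]
        gcongr
        exact hDL k x
      · rw [Set.indicator_of_notMem hx, hDsupp k hk.2 x hx, zero_smul, norm_zero]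
    · exact (integrable_indicator_iff Metric.isClosed_cthickening.measurableSet).2
        ((hWint v hv).norm.const_mul _)
    · refine ae_of_all _ fun x => Tendsto.smul_const ?_ _
      have hd : HasLineDerivAt ℝ φ (fderiv ℝ φ x (-ξ)) x (-ξ) :=
        ((hφ.differentiable (by simp)) x).hasFDerivAt.hasLineDerivAt (-ξ)
      have h1 := hd.tendsto_slope_zero_right
      rw [map_neg] at h1
      have h2 : Tendsto ε atTop (𝓝[>] 0) :=
        tendsto_nhdsWithin_iff.2 ⟨hε, Eventually.of_forall hε_pos⟩
      have h3 := h1.comp h2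
      refine h3.congr fun k => ?_
      simp [hD, sub_eq_add_neg]
  have := hfirst.add hsecond
  simp only [neg_smul, integral_neg, zero_add] at this
  exact this

/-- If the difference quotients of `w k` in the direction `ξ` are bounded in `L^p` along a
subsequence, their weak limit is the weak derivative of the limit of `w k`. -/
theorem exists_hasWeakDirDeriv_of_frequently_le {E F : Type*} [NormedAddCommGroup E]
    [NormedSpace ℝ E] [MeasurableSpace E] [BorelSpace E] [FiniteDimensional ℝ E] (μ : Measure E)
    [μ.IsAddHaarMeasure] [NormedAddCommGroup F] [NormedSpace ℝ F] [StrictConvexSpace ℝ F]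
    [FiniteDimensional ℝ F] {p : ℝ≥0∞} [Fact (1 ≤ p)] (hp : 1 < p)
    (hp_top : p ≠ ∞) {A : Set E} (hA : IsOpen A) {w : ℕ → E → F} {v : E → F}
    (hwm : ∀ k, StronglyMeasurable (w k)) (hw : ∀ k, MemLp (w k) p μ) (hv : MemLp v p μ)
    (hwv : Tendsto (fun k => eLpNorm (w k - v) p μ) atTop (𝓝 0)) {ε : ℕ → ℝ}
    (hε_pos : ∀ k, 0 < ε k) (hε : Tendsto ε atTop (𝓝 0)) (ξ : E) {c : ℝ≥0∞} (hc : c ≠ ∞)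
    (hbdd : ∃ᶠ k in atTop, eLpNorm (differenceQuotient A (ε k) ξ (w k)) p μ ≤ c) :
    ∃ g : E → F, MemLp g p (μ.restrict A) ∧ HasWeakDirDeriv μ A v ξ g := by
  have hcompF : CompleteSpace F := FiniteDimensional.complete ℝ F
  obtain ⟨ψ, hψ, hψc⟩ := extraction_of_frequently_atTop hbdd
  set Q : ℕ → E → F := fun k => differenceQuotient A (ε (ψ k)) ξ (w (ψ k)) with hQ
  have hQle : ∀ k, eLpNorm (Q k) p (μ.restrict A) ≤ c := fun k =>
    (eLpNorm_restrict_le _ _ _ _).trans (hψc k)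
  have hQm : ∀ k, MemLp (Q k) p (μ.restrict A) := fun k =>
    ⟨(stronglyMeasurable_differenceQuotient hA _ ξ (hwm _)).aestronglyMeasurable,
      (hQle k).trans_lt (lt_top_iff_ne_top.2 hc)⟩
  obtain ⟨g, hg⟩ := Lp.exists_forall_eq_of_tendsto_of_norm_le (μ.restrict A) hp hp_top
    (fun k => (hQm k).toLp (Q k)) (R := c.toReal) (fun k => by
      rw [Lp.norm_toLp]
      exact ENNReal.toReal_mono hc (hQle k))
  refine ⟨g, Lp.memLp g, fun φ hφ hφc hφA => ?_⟩
  set p' := ENNReal.conjExponent p with hp'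
  have hconj : ENNReal.HolderConjugate p' p := (ENNReal.HolderConjugate.conjExponent hp.le).symm
  have hp'1 : Fact (1 ≤ p') := ⟨hconj.one_le⟩
  have hφp : MemLp φ p' (μ.restrict A) :=
    (hφ.continuous.memLp_of_hasCompactSupport hφc).restrict A
  set ℓ : Lp F p (μ.restrict A) →L[ℝ] F :=
    (ContinuousLinearMap.lsmul ℝ ℝ (E := F)).lpPairing (μ.restrict A) p' p (hφp.toLp φ) with hℓ
  have hℓ_eq : ∀ f : Lp F p (μ.restrict A), ℓ f = ∫ x in A, φ x • f x ∂μ := by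
    intro f
    rw [hℓ, ContinuousLinearMap.lpPairing_eq_integral]
    refine integral_congr_ae ?_
    filter_upwards [hφp.coeFn_toLp] with x hx
    rw [hx, ContinuousLinearMap.lsmul_apply]
  have hlim := (tendsto_integral_smul_differenceQuotient μ hp.le hp_top hA hw hv hwv hε_pos hε ξ
    hφ hφc hφA).comp hψ.tendsto_atTop
  have h1 : ∫ x, fderiv ℝ φ x ξ • v x ∂μ = ∫ x in A, fderiv ℝ φ x ξ • v x ∂μ := by
    refine (setIntegral_eq_integral_of_forall_compl_eq_zero fun x hx => ?_).symm
    have : fderiv ℝ φ x = 0 := by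
      by_contra h
      exact hx (hφA (support_fderiv_subset ℝ h))
    rw [this]
    simp
  have hgT := hg ℓ _ (hlim.congr fun k => by
    rw [hℓ_eq]
    have h2 : ∫ x in A, φ x • (hQm k).toLp (Q k) x ∂μ = ∫ x in A, φ x • Q k x ∂μ := by
      refine integral_congr_ae ?_
      filter_upwards [(hQm k).coeFn_toLp] with x hx
      rw [hx]
    rw [h2]
    refine (setIntegral_eq_integral_of_forall_compl_eq_zero fun x hx => ?_).symm
    rw [image_eq_zero_of_notMem_tsupport fun h => hx (hφA h), zero_smul])
  rw [hℓ_eq, h1] at hgT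
  rw [hgT, neg_neg]

theorem eLpNorm_differenceQuotient_rpow {E F : Type*} [NormedAddCommGroup E]
    [NormedSpace ℝ E] [MeasurableSpace E] [BorelSpace E] (μ : Measure E)
    [NormedAddCommGroup F] [NormedSpace ℝ F] {p : ℝ≥0∞} (hp : 1 ≤ p) (hp_top : p ≠ ∞)
    {A : Set E} (hA : IsOpen A) (ε : ℝ) (ξ : E) (w : E → F) :
    eLpNorm (differenceQuotient A ε ξ w) p μ ^ p.toReal =
      ∫⁻ x in shiftSet A ε ξ, ‖ε⁻¹ • (w (x + ε • ξ) - w x)‖ₑ ^ p.toReal ∂μ := by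
  have hp0 : p ≠ 0 := (zero_lt_one.trans_le hp).ne'
  have hq : 0 < p.toReal := ENNReal.toReal_pos hp0 hp_top
  rw [differenceQuotient, eLpNorm_indicator_eq_eLpNorm_restrict
    (isOpen_shiftSet hA ε ξ).measurableSet, eLpNorm_eq_lintegral_rpow_enorm_toReal hp0 hp_top,
    ← ENNReal.rpow_mul, one_div_mul_cancel hq.ne', ENNReal.rpow_one]

/-- By Fatou's lemma, an energy bound gives, for almost every direction, a bound on the difference
quotients along a subsequence, which may depend on the direction. -/
theorem ae_exists_frequently_eLpNorm_differenceQuotient_le {E F : Type*} [NormedAddCommGroup E]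
    [NormedSpace ℝ E] [MeasurableSpace E] [BorelSpace E] [FiniteDimensional ℝ E] (μ : Measure E)
    [SFinite μ] [NormedAddCommGroup F] [NormedSpace ℝ F] {p : ℝ≥0∞} (hp : 1 ≤ p)
    (hp_top : p ≠ ∞) {A : Set E} (hA : IsOpen A) {w : ℕ → E → F}
    (hwm : ∀ k, StronglyMeasurable (w k)) (ε : ℕ → ℝ) {B : Set E} {C : ℝ≥0∞} (hC : C ≠ ∞)
    (hG : ∀ k, ∫⁻ ξ in B, eLpNorm (differenceQuotient A (ε k) ξ (w k)) p μ ^ p.toReal ∂μ ≤ C) :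
    ∀ᵐ ξ ∂(μ.restrict B), ∃ c : ℝ≥0∞, c ≠ ∞ ∧
      ∃ᶠ k in atTop, eLpNorm (differenceQuotient A (ε k) ξ (w k)) p μ ≤ c := by
  have hprop : ProperSpace E := FiniteDimensional.proper ℝ E
  have hq : 0 < p.toReal := ENNReal.toReal_pos (zero_lt_one.trans_le hp).ne' hp_top
  set Φ : ℕ → E → ℝ≥0∞ := fun k ξ =>
    eLpNorm (differenceQuotient A (ε k) ξ (w k)) p μ ^ p.toReal with hΦ
  have hΦm : ∀ k, Measurable (Φ k) := by
    intro k
    have hset : MeasurableSet {z : E × E | z.2 ∈ shiftSet A (ε k) z.1} :=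
      ((hA.preimage continuous_snd).inter
        (hA.preimage (continuous_snd.add (continuous_fst.const_smul (ε k))))).measurableSet
    have hm : Measurable fun z : E × E =>
        ‖(ε k)⁻¹ • (w k (z.2 + ε k • z.1) - w k z.2)‖ₑ ^ p.toReal :=
      ((((hwm k).comp_measurable (g := fun z : E × E => z.2 + ε k • z.1) (by fun_prop)).sub
        ((hwm k).comp_measurable measurable_snd)).const_smul (ε k)⁻¹).enorm.pow_const _
    have heq : Φ k = fun ξ => ∫⁻ x, {z : E × E | z.2 ∈ shiftSet A (ε k) z.1}.indicator (fun z =>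
        ‖(ε k)⁻¹ • (w k (z.2 + ε k • z.1) - w k z.2)‖ₑ ^ p.toReal) (ξ, x) ∂μ := by
      funext ξ
      simp only [hΦ]
      rw [eLpNorm_differenceQuotient_rpow μ hp hp_top hA,
        ← lintegral_indicator (isOpen_shiftSet hA (ε k) ξ).measurableSet]
      rfl
    rw [heq]
    exact (hm.indicator hset).lintegral_prod_right'
  have hfatou : ∫⁻ ξ in B, liminf (fun k => Φ k ξ) atTop ∂μ ≠ ∞ := by
    refine ne_top_of_le_ne_top hC ((lintegral_liminf_le hΦm).trans ?_)
    exact liminf_le_of_le (by isBoundedDefault) fun b hb => by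
      obtain ⟨k, hk⟩ := hb.exists
      exact hk.trans (hG k)
  have hlt := ae_lt_top (Measurable.liminf hΦm) hfatou
  filter_upwards [hlt] with ξ hξ
  obtain ⟨c, hc1, hc2⟩ := exists_between hξ
  refine ⟨c ^ p.toReal⁻¹, ENNReal.rpow_ne_top_of_nonneg (by positivity) hc2.ne, ?_⟩
  refine (frequently_lt_of_liminf_lt (by isBoundedDefault) hc1).mono fun k hk => ?_
  rw [ENNReal.le_rpow_inv_iff hq]
  exact hk.le

/-- The directions in which `v` has a weak derivative in `L^p(A)` form a linear subspace. -/
def weakDirDerivSubmodule {E F : Type*} [NormedAddCommGroup E] [NormedSpace ℝ E]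
    [MeasurableSpace E] [BorelSpace E] [NormedAddCommGroup F]
    [NormedSpace ℝ F] (μ : Measure E) [IsLocallyFiniteMeasure μ] {p : ℝ≥0∞} (hp : 1 ≤ p)
    (A : Set E) {v : E → F} (hv : MemLp v p (μ.restrict A)) : Submodule ℝ E where
  carrier := {ξ | ∃ g : E → F, MemLp g p (μ.restrict A) ∧ HasWeakDirDeriv μ A v ξ g}
  zero_mem' := ⟨0, MemLp.zero, fun φ _ _ _ => by simp⟩
  add_mem' := by
    rintro ξ ξ' ⟨g, hg, hgv⟩ ⟨g', hg', hgv'⟩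
    refine ⟨g + g', hg.add hg', fun φ hφ hφc hφA => ?_⟩
    have hint : ∀ f : E → F, MemLp f p (μ.restrict A) → ∀ θ : E → ℝ, Continuous θ →
        HasCompactSupport θ → Integrable (fun x => θ x • f x) (μ.restrict A) := fun f hf θ hθ hθc =>
      (hf.locallyIntegrable hp).integrable_smul_left_of_hasCompactSupport hθ hθc
    have hd : ∀ ζ : E, Integrable (fun x => fderiv ℝ φ x ζ • v x) (μ.restrict A) := fun ζ =>
      hint v hv _ ((hφ.continuous_fderiv (by simp)).clm_apply continuous_const)
        (hφc.fderiv_apply ℝ ζ)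
    simp only [map_add, add_smul, Pi.add_apply, smul_add]
    rw [integral_add (hd ξ) (hd ξ'), integral_add (hint g hg φ hφ.continuous hφc)
      (hint g' hg' φ hφ.continuous hφc), hgv φ hφ hφc hφA, hgv' φ hφ hφc hφA, neg_add]
  smul_mem' := by
    rintro a ξ ⟨g, hg, hgv⟩
    refine ⟨a • g, hg.const_smul a, fun φ hφ hφc hφA => ?_⟩
    have h := hgv φ hφ hφc hφA
    simp only [map_smul, smul_assoc, Pi.smul_apply, smul_comm (φ _) a]
    rw [integral_smul, integral_smul, h, smul_neg]

theorem memLp_smulRight {X E F : Type*} [MeasurableSpace X] {μ : Measure X}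
    [NormedAddCommGroup E] [NormedSpace ℝ E] [NormedAddCommGroup F] [NormedSpace ℝ F] {p : ℝ≥0∞}
    (c : E →L[ℝ] ℝ) {g : X → F} (hg : MemLp g p μ) : MemLp (fun x => c.smulRight (g x)) p μ := by
  have h : Continuous fun y : F => c.smulRight y :=
    (ContinuousLinearMap.smulRightL ℝ E F c).continuous
  refine hg.of_le_mul (c := ‖c‖) (h.comp_aestronglyMeasurable hg.aestronglyMeasurable)
    (ae_of_all _ fun x => ?_)
  rw [ContinuousLinearMap.norm_smulRight_apply]

/-- Weak derivatives in all directions assemble to a weak gradient. -/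
theorem memW1p_of_forall_hasWeakDirDeriv {d m : ℕ} {p : ℝ≥0∞} (hp : 1 ≤ p)
    {A : Set (EuclideanSpace ℝ (Fin d))}
    {v : EuclideanSpace ℝ (Fin d) → EuclideanSpace ℝ (Fin m)}
    (hv : MemLp v p (volume.restrict A))
    (h : ∀ ξ, ∃ g : EuclideanSpace ℝ (Fin d) → EuclideanSpace ℝ (Fin m),
      MemLp g p (volume.restrict A) ∧ HasWeakDirDeriv volume A v ξ g) : MemW1p p A v := by
  choose g hg hgv using fun i : Fin d => h (EuclideanSpace.single i 1)
  refine ⟨hv, fun x => ∑ i, (EuclideanSpace.proj (𝕜 := ℝ) i).smulRight (g i x), ?_, ?_⟩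
  · exact memLp_finsetSum (f := fun i x => (EuclideanSpace.proj (𝕜 := ℝ) i).smulRight (g i x))
      Finset.univ fun i _ => memLp_smulRight _ (hg i)
  · intro φ hφ hφc hφA ζ
    have hζ : ζ = ∑ i, ζ i • EuclideanSpace.single i (1 : ℝ) := by
      ext k
      simp [Pi.single_apply]
    have hd : ∀ ξ, Integrable (fun x => fderiv ℝ φ x ξ • v x) (volume.restrict A) := fun ξ =>
      (hv.locallyIntegrable hp).integrable_smul_left_of_hasCompactSupport
        ((hφ.continuous_fderiv (by simp)).clm_apply continuous_const) (hφc.fderiv_apply ℝ ξ)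
    have hi : ∀ i, Integrable (fun x => φ x • g i x) (volume.restrict A) := fun i =>
      ((hg i).locallyIntegrable hp).integrable_smul_left_of_hasCompactSupport hφ.continuous hφc
    have h1 : ∀ x, fderiv ℝ φ x ζ • v x =
        ∑ i, ζ i • (fderiv ℝ φ x (EuclideanSpace.single i 1) • v x) := by
      intro x
      conv_lhs => rw [hζ]
      simp only [map_sum, map_smul, Finset.sum_smul, smul_assoc]
    have h2 : ∀ x, φ x • (∑ i, (EuclideanSpace.proj (𝕜 := ℝ) i).smulRight (g i x) :
        EuclideanSpace ℝ (Fin d) →L[ℝ] EuclideanSpace ℝ (Fin m)) ζ =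
        ∑ i, ζ i • (φ x • g i x) := by
      intro x
      simp only [sum_apply, ContinuousLinearMap.smulRight_apply, Finset.smul_sum, smul_comm (φ x)]
      rfl
    simp only [h1, h2]
    rw [integral_finsetSum (f := fun i x => ζ i • fderiv ℝ φ x (EuclideanSpace.single i 1) • v x) _
        fun i _ => (hd _).smul (ζ i),
      integral_finsetSum (f := fun i x => ζ i • φ x • g i x) _ fun i _ => (hi i).smul (ζ i),
      ← Finset.sum_neg_distrib]
    refine Finset.sum_congr rfl fun i _ => ?_
    rw [integral_smul, integral_smul, hgv i φ hφ hφc hφA, smul_neg]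

/-! ### Compactness in `L^p` and regularity of limits -/

theorem lintegral_eLpNorm_differenceQuotient_indicator {d m : ℕ} {p : ℝ≥0∞} (hp : 1 ≤ p)
    (hp_top : p ≠ ∞) {A : Set (EuclideanSpace ℝ (Fin d))} (hA : IsOpen A) (r ε : ℝ)
    (u : EuclideanSpace ℝ (Fin d) → EuclideanSpace ℝ (Fin m)) :
    ∫⁻ ξ in Metric.ball 0 r, eLpNorm (differenceQuotient A ε ξ (A.indicator u)) p ^ p.toReal =
      ballFunctional p.toReal r ε u A := by
  rw [ballFunctional, convFunctional, ← lintegral_indicator measurableSet_ball]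
  refine lintegral_congr fun ξ => ?_
  by_cases hξ : ξ ∈ Metric.ball (0 : EuclideanSpace ℝ (Fin d)) r
  · rw [Set.indicator_of_mem hξ, Set.indicator_of_mem hξ,
      eLpNorm_differenceQuotient_rpow volume hp hp_top hA]
    simp only [Pi.one_apply, ENNReal.coe_one, one_mul]
    refine setLIntegral_congr_fun (isOpen_shiftSet hA ε ξ).measurableSet fun x hx => ?_
    simp only [Set.indicator_of_mem hx.1, Set.indicator_of_mem hx.2]
  · rw [Set.indicator_of_notMem hξ, Set.indicator_of_notMem hξ, ENNReal.coe_zero, zero_mul]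

theorem eLpNorm_shift_sub_eq_ofReal_mul {E F : Type*} [NormedAddCommGroup E]
    [NormedSpace ℝ E] [MeasurableSpace E] [BorelSpace E] (μ : Measure E)
    [NormedAddCommGroup F] [NormedSpace ℝ F] (p : ℝ≥0∞) {A : Set E} (hA : IsOpen A) {ε : ℝ}
    (hε : 0 < ε) (ξ : E) (w : E → F) :
    eLpNorm (fun x => w (x + ε • ξ) - w x) p (μ.restrict (shiftSet A ε ξ)) =
      ENNReal.ofReal ε * eLpNorm (differenceQuotient A ε ξ w) p μ := by
  rw [differenceQuotient, eLpNorm_indicator_eq_eLpNorm_restrict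
    (isOpen_shiftSet hA ε ξ).measurableSet, ← Real.enorm_of_nonneg hε.le, ← eLpNorm_const_smul]
  congr 1
  funext x
  simp only [Pi.smul_apply, smul_smul, mul_inv_cancel₀ hε.ne', one_smul]

theorem mainTheorem3 {d m : ℕ} (p : ℝ≥0∞) [Fact (1 ≤ p)] (hp : 1 < p) (hp_top : p ≠ ∞)
    (A : Set (EuclideanSpace ℝ (Fin d))) (hA_open : IsOpen A)
    (hA_lip : HasLipschitzBoundary A) (hA_bdry : Bornology.IsBounded (frontier A))
    (u : ℝ → Lp (EuclideanSpace ℝ (Fin m)) p (volume.restrict A))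
    (r : ℝ) (hr : 0 < r)
    (hu : (⨆ ε ∈ Set.Ioi (0 : ℝ),
      (eLpNorm (u ε) p (volume.restrict A) + ballFunctional p.toReal r ε (u ε) A)) < ∞)
    (htails : ¬ Bornology.IsBounded A → ∀ η : ℝ, 0 < η → ∃ R : ℝ, 0 < R ∧
      (⨆ ε ∈ Set.Ioi (0 : ℝ), eLpNorm (u ε) p (volume.restrict (A \ Metric.ball 0 R)))
        < ENNReal.ofReal η)
    (ε : ℕ → ℝ) (hε_pos : ∀ j, 0 < ε j) (hε : Tendsto ε atTop (𝓝 0)) :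
    IsCompact (closure (Set.range fun j => u (ε j))) ∧
      ∀ (φ : ℕ → ℕ) (v : Lp (EuclideanSpace ℝ (Fin m)) p (volume.restrict A)),
        StrictMono φ → Tendsto (fun k => u (ε (φ k))) atTop (𝓝 v) → MemW1p p A v := by
  have hq : 0 < p.toReal := ENNReal.toReal_pos (zero_lt_one.trans hp).ne' hp_top
  have hAm := hA_open.measurableSet
  set C := ⨆ ε ∈ Set.Ioi (0 : ℝ),
    (eLpNorm (u ε) p (volume.restrict A) + ballFunctional p.toReal r ε (u ε) A) with hC
  have hle : ∀ j, eLpNorm (u (ε j)) p (volume.restrict A) +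
      ballFunctional p.toReal r (ε j) (u (ε j)) A ≤ C := fun j =>
    le_iSup₂ (f := fun (ε : ℝ) (_ : ε ∈ Set.Ioi (0 : ℝ)) =>
      eLpNorm (u ε) p (volume.restrict A) + ballFunctional p.toReal r ε (u ε) A) (ε j) (hε_pos j)
  set w : ℕ → EuclideanSpace ℝ (Fin d) → EuclideanSpace ℝ (Fin m) :=
    fun j => A.indicator (u (ε j)) with hw
  have hwm : ∀ j, StronglyMeasurable (w j) := fun j => (Lp.stronglyMeasurable _).indicator hAm
  have hwC : ∀ j, eLpNorm (w j) p volume ≤ C := fun j => by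
    rw [hw, eLpNorm_indicator_eq_eLpNorm_restrict hAm]
    exact le_self_add.trans (hle j)
  have hwG : ∀ j, ∫⁻ ξ in Metric.ball 0 r,
      eLpNorm (differenceQuotient A (ε j) ξ (w j)) p ^ p.toReal ≤ C := fun j => by
    rw [hw, lintegral_eLpNorm_differenceQuotient_indicator hp.le hp_top hA_open]
    exact le_add_self.trans (hle j)
  have hwLp : ∀ j, MemLp (w j) p volume := fun j =>
    ⟨(hwm j).aestronglyMeasurable, (hwC j).trans_lt hu⟩
  refine ⟨isCompact_closure_range_of_ultrafilter _ fun 𝒰 h𝒰 => ?_, fun φ v hφ hv => ?_⟩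
  · have hcauchy : CauchyAlong volume p 𝒰 w A := by
      refine cauchyAlong_of_locally hp.le hp_top hwm (fun x₀ hx₀ => ?_) fun κ hκ => ?_
      · obtain ⟨ρ, hρ, ξ₀, s, hs, hball, δ₀, hδ₀, hcone⟩ :=
          hA_lip.exists_uniform_cone hA_open hr hx₀
        refine ⟨ρ, hρ, ?_⟩
        set C' := C + C ^ p.toReal⁻¹ with hC'
        have hC'top : C' ≠ ∞ :=
          ENNReal.add_ne_top.2 ⟨hu.ne, ENNReal.rpow_ne_top_of_nonneg (by positivity) hu.ne⟩
        refine cauchyAlong_of_uniform_cone volume hp.le hp_top hA_open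
          (hAm.inter measurableSet_ball) (Metric.isBounded_ball.subset Set.inter_subset_right)
          hs hδ₀ hball hcone hwm hC'top (fun j => (hwC j).trans le_self_add) hε_pos hε
          (fun j => ?_) h𝒰
        simp only [eLpNorm_shift_sub_eq_ofReal_mul volume p hA_open (hε_pos j),
          ENNReal.mul_rpow_of_nonneg _ _ hq.le]
        rw [lintegral_const_mul' _ _ (ENNReal.rpow_ne_top_of_nonneg hq.le ENNReal.ofReal_ne_top)]
        gcongr
        refine (hwG j).trans ?_
        rw [← ENNReal.rpow_inv_le_iff hq]
        exact le_add_self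
      · have hind : ∀ (j : ℕ) (R : ℝ), eLpNorm (w j) p (volume.restrict (A \ Metric.ball 0 R)) =
            eLpNorm (u (ε j)) p (volume.restrict (A \ Metric.ball 0 R)) := fun j R => by
          refine eLpNorm_congr_ae ?_
          filter_upwards [ae_restrict_mem (hAm.diff measurableSet_ball)] with x hx
          exact Set.indicator_of_mem hx.1 _
        by_cases hb : Bornology.IsBounded A
        · obtain ⟨R, hR⟩ := hb.subset_ball 0
          refine ⟨R, fun j => ?_⟩
          rw [Set.sdiff_eq_empty.2 hR]
          simp
        · obtain ⟨η, hη0, hηκ⟩ := ENNReal.lt_iff_exists_nnreal_btwn.1 (pos_iff_ne_zero.2 hκ)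
          obtain ⟨R, -, hR⟩ := htails hb η (by exact_mod_cast hη0)
          rw [ENNReal.ofReal_coe_nnreal] at hR
          refine ⟨R, fun j => ?_⟩
          rw [hind]
          refine le_trans ?_ (hR.le.trans hηκ.le)
          exact le_iSup₂ (f := fun (ε : ℝ) (_ : ε ∈ Set.Ioi (0 : ℝ)) =>
            eLpNorm (u ε) p (volume.restrict (A \ Metric.ball 0 R))) (ε j) (hε_pos j)
    intro κ hκ
    obtain ⟨T, hT, h⟩ := hcauchy κ hκ
    refine ⟨T, hT, fun i hi j hj => ?_⟩
    rw [Lp.edist_def]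
    refine le_of_eq_of_le (eLpNorm_congr_ae ?_) (h i hi j hj)
    filter_upwards [ae_restrict_mem hAm] with x hx
    simp only [hw, Pi.sub_apply, Set.indicator_of_mem hx]
  · have hV : MemLp (A.indicator v) p volume :=
      (memLp_indicator_iff_restrict hAm).2 (Lp.memLp v)
    have hwv : Tendsto (fun k => eLpNorm (w (φ k) - A.indicator v) p volume) atTop (𝓝 0) := by
      have h1 := (tendsto_iff_edist_tendsto_0.1 hv)
      refine h1.congr fun k => ?_
      rw [Lp.edist_def, hw, ← Set.indicator_sub', eLpNorm_indicator_eq_eLpNorm_restrict hAm]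
    have hVA : MemLp (A.indicator v) p (volume.restrict A) := hV.restrict A
    set M := weakDirDerivSubmodule volume hp.le A hVA with hM
    have hae := ae_exists_frequently_eLpNorm_differenceQuotient_le volume hp.le hp_top hA_open
      (fun k => hwm (φ k)) (fun k => ε (φ k)) hu.ne (fun k => hwG (φ k))
    have hmem : ∀ᵐ ξ ∂(volume.restrict (Metric.ball (0 : EuclideanSpace ℝ (Fin d)) r)), ξ ∈ M := by
      filter_upwards [hae] with ξ ⟨c, hc, hfreq⟩
      exact exists_hasWeakDirDeriv_of_frequently_le volume hp hp_top hA_open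
        (fun k => hwm (φ k)) (fun k => hwLp (φ k)) hV hwv (fun k => hε_pos (φ k))
        (hε.comp hφ.tendsto_atTop) ξ hc hfreq
    -- a proper subspace is negligible, so it cannot contain almost all of a ball
    have htop : M = ⊤ := by
      by_contra hne
      have h0 := Measure.addHaar_submodule volume M hne
      have h1 : ∀ᵐ ξ ∂(volume.restrict (Metric.ball (0 : EuclideanSpace ℝ (Fin d)) r)), ξ ∉ M :=
        ae_restrict_of_ae (measure_eq_zero_iff_ae_notMem.1 h0)
      have h2 : ∀ᵐ ξ ∂(volume.restrict (Metric.ball (0 : EuclideanSpace ℝ (Fin d)) r)), False := by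
        filter_upwards [hmem, h1] with ξ h h' using h' h
      rw [ae_iff] at h2
      simp only [not_false_eq_true, Set.ofPred_true, Measure.restrict_apply_univ] at h2
      exact (Metric.measure_ball_pos volume 0 hr).ne' h2
    refine memW1p_of_forall_hasWeakDirDeriv hp.le (Lp.memLp v) fun ξ => ?_
    obtain ⟨g, hg, hgv⟩ : ξ ∈ M := htop ▸ Submodule.mem_top
    refine ⟨g, hg, fun ψ hψ hψc hψA => ?_⟩
    rw [← hgv ψ hψ hψc hψA]
    refine setIntegral_congr_fun hAm fun x hx => ?_
    simp only [Set.indicator_of_mem hx]
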